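/- Let $n\ge 2$ and let $\bar D_n$ be the double dihedral (generalized quaternion) group of order $4n$, generated by $R, X$ with relations $R^{2n}=e$, $X^2=R^n$, $XR=R^{-1}X$. Every element is written uniquely as $X^AR^a$ with $A\in\{0,1\}$ and $a\in\{-n+1,\dots,n\}$; for $x\in\mathbb Z$ let $\langle x\rangle_{2n}$ be the integer in $\{-n+1,\dots,n\}$ congruent to $x$ modulo $2n$. Let $k$ be a field containing a primitive $2n^2$-th root of unity $\xi$ and an element $\xi_4$ with $\xi_4^2=\xi^{n^2}$ $(=-1)$; when $n$ is even one may take $\xi_4=\xi^{n^2/2}$. For $p\in\{0,\dots,2n-1\}$ let $\omega_p:\bar D_n^3\to k^*$ be the normalized $3$-cocycle $$\omega_p(X^AR^a,X^BR^b,X^CR^c)=\xi^{\,p(-1)^{B+C}a\left((-1)^Cb+c-\langle(-1)^Cb+c+nBC\rangle_{2n}\right)}\;\xi_4^{-pABC}.$$ Let $H=(k^{\bar D_n},\Phi_{\omega_p})$ be the quasi-Hopf algebra of $k$-valued functions on $\bar D_n$, with pointwise multiplication, comultiplication $\Delta(P_g)=\sum_{xy=g}P_x\otimes P_y$ and counit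 $\varepsilon(P_g)=\delta_{g,e}$ (where $P_g$ is the indicator function of $g$), reassociator $\Phi_{\omega_p}=\sum_{x,y,z}\omega_p(x,y,z)\,P_x\otimes P_y\otimes P_z$, and antipode $S(P_g)=P_{g^{-1}}$, $\alpha=1$, $\beta=\sum_g\omega_p(g,g^{-1},g)^{-1}P_g$. Let ${}_H^H\mathcal{YD}$ be the braided monoidal category of left Yetter–Drinfeld modules over $H$. A braided Hopf algebra means a Hopf algebra in ${}_H^H\mathcal{YD}$; it is called trivial if it is isomorphic, as such, to the group Hopf algebra $k[C_2]$ of the cyclic group of order $2$ with trivial action $h\cdot x=\varepsilon(h)x$ and trivial coaction $x\mapsto 1\otimes x$. Then there exists a non-trivial braided Hopf algebra in ${}_H^H\mathcal{YD}$ of dimension $2$ over $k$ if and only if either $p$ is odd, or $p$ and $n$ have different parities. -/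

import Mathlib

open scoped TensorProduct

universe u

/-! ## Quasi-bialgebras and quasi-Hopf algebras -/

section QuasiHopf

variable (k H : Type*) [Field k] [Ring H] [Algebra k H]

/-- A quasi-bialgebra `(H, Δ, ε, Φ)`; triple tensor products are bracketed to the right. -/
structure QuasiBialgebra where
  /-- the comultiplication -/
  Δ : H →ₐ[k] H ⊗[k] H
  /-- the counit -/
  ε : H →ₐ[k] k
  /-- the reassociator, an invertible element of `H ⊗ H ⊗ H` -/
  Φ : (H ⊗[k] (H ⊗[k] H))ˣ
  /-- `(id ⊗ Δ)(Δ h) = Φ (Δ ⊗ id)(Δ h) Φ⁻¹` -/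
  quasi_coassoc : ∀ h : H,
    Algebra.TensorProduct.map (AlgHom.id k H) Δ (Δ h) =
      (Φ : H ⊗[k] (H ⊗[k] H)) *
        Algebra.TensorProduct.assoc k k k H H H
          (Algebra.TensorProduct.map Δ (AlgHom.id k H) (Δ h)) *
        ((Φ⁻¹ : (H ⊗[k] (H ⊗[k] H))ˣ) : H ⊗[k] (H ⊗[k] H))
  /-- `(id ⊗ ε)(Δ h) = h` -/
  counit_right : ∀ h : H,
    Algebra.TensorProduct.rid k k H
      (Algebra.TensorProduct.map (AlgHom.id k H) ε (Δ h)) = h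
  /-- `(ε ⊗ id)(Δ h) = h` -/
  counit_left : ∀ h : H,
    Algebra.TensorProduct.lid k H
      (Algebra.TensorProduct.map ε (AlgHom.id k H) (Δ h)) = h
  /-- `(id ⊗ ε ⊗ id)(Φ) = 1 ⊗ 1` -/
  normalized :
    Algebra.TensorProduct.map (AlgHom.id k H)
      ((Algebra.TensorProduct.lid k H).toAlgHom.comp
        (Algebra.TensorProduct.map ε (AlgHom.id k H)))
      (Φ : H ⊗[k] (H ⊗[k] H)) = 1
  /-- `(1 ⊗ Φ) (id ⊗ Δ ⊗ id)(Φ) (Φ ⊗ 1) = (id ⊗ id ⊗ Δ)(Φ) (Δ ⊗ id ⊗ id)(Φ)` -/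
  cocycle :
    ((1 : H) ⊗ₜ[k] (Φ : H ⊗[k] (H ⊗[k] H))) *
      Algebra.TensorProduct.map (AlgHom.id k H)
        ((Algebra.TensorProduct.assoc k k k H H H).toAlgHom.comp
          (Algebra.TensorProduct.map Δ (AlgHom.id k H)))
        (Φ : H ⊗[k] (H ⊗[k] H)) *
      Algebra.TensorProduct.map (AlgHom.id k H)
        (Algebra.TensorProduct.assoc k k k H H H).toAlgHom
        (Algebra.TensorProduct.assoc k k k H (H ⊗[k] H) H
          ((Φ : H ⊗[k] (H ⊗[k] H)) ⊗ₜ[k] (1 : H))) =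
    Algebra.TensorProduct.map (AlgHom.id k H)
        (Algebra.TensorProduct.map (AlgHom.id k H) Δ)
        (Φ : H ⊗[k] (H ⊗[k] H)) *
      Algebra.TensorProduct.assoc k k k H H (H ⊗[k] H)
        (Algebra.TensorProduct.map Δ (AlgHom.id k (H ⊗[k] H))
          (Φ : H ⊗[k] (H ⊗[k] H)))

/-- A quasi-Hopf algebra: a quasi-bialgebra with an antipode `(S, α, β)`. -/
structure QuasiHopfAlgebra extends QuasiBialgebra k H where
  /-- the antipode, an anti-morphism of algebras -/
  S : H →ₗ[k] H
  S_one : S 1 = 1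
  S_mul : ∀ a b : H, S (a * b) = S b * S a
  α : H
  β : H
  /-- `S(h₁) α h₂ = ε(h) α` -/
  antipode_left : ∀ h : H,
    LinearMap.mul' k H
      (TensorProduct.map (LinearMap.mulRight k α ∘ₗ S) LinearMap.id (Δ h)) = ε h • α
  /-- `h₁ β S(h₂) = ε(h) β` -/
  antipode_right : ∀ h : H,
    LinearMap.mul' k H
      (TensorProduct.map (LinearMap.mulRight k β) S (Δ h)) = ε h • β
  /-- `X¹ β S(X²) α X³ = 1`, where `Φ = X¹ ⊗ X² ⊗ X³` -/
  antipode_reassociator :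
    LinearMap.mul' k H
      (TensorProduct.map (LinearMap.mulRight k β)
        (LinearMap.mul' k H ∘ₗ
          TensorProduct.map (LinearMap.mulRight k α ∘ₗ S) LinearMap.id)
        (Φ : H ⊗[k] (H ⊗[k] H))) = 1
  /-- `S(x¹) α x² β S(x³) = 1`, where `Φ⁻¹ = x¹ ⊗ x² ⊗ x³` -/
  antipode_reassociator_inv :
    LinearMap.mul' k H
      (TensorProduct.map (LinearMap.mulRight k α ∘ₗ S)
        (LinearMap.mul' k H ∘ₗ TensorProduct.map (LinearMap.mulRight k β) S)
        ((Φ⁻¹ : (H ⊗[k] (H ⊗[k] H))ˣ) : H ⊗[k] (H ⊗[k] H))) = 1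

end QuasiHopf

/-! ## Representations of a quasi-bialgebra, Yetter-Drinfeld modules -/

section Representations

variable {k : Type*} [Field k]

/-- The action of `A ⊗ A'` on `M ⊗ N` given by `(a ⊗ a') · (m ⊗ n) = a·m ⊗ a'·n`. -/
noncomputable def tensorAct {A A' M N : Type*} [Ring A] [Algebra k A] [Ring A'] [Algebra k A']
    [AddCommGroup M] [Module k M] [AddCommGroup N] [Module k N]
    (ρ : A →ₐ[k] Module.End k M) (σ : A' →ₐ[k] Module.End k N) :
    A ⊗[k] A' →ₐ[k] Module.End k (M ⊗[k] N) :=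
  (Module.endTensorEndAlgHom (R := k) (S := k) (A := k) (M := M) (N := N)).comp
    (Algebra.TensorProduct.map ρ σ)

@[simp] theorem tensorAct_tmul_tmul {A A' M N : Type*} [Ring A] [Algebra k A] [Ring A']
    [Algebra k A'] [AddCommGroup M] [Module k M] [AddCommGroup N] [Module k N]
    (ρ : A →ₐ[k] Module.End k M) (σ : A' →ₐ[k] Module.End k N)
    (x : A) (x' : A') (m : M) (n : N) :
    tensorAct ρ σ (x ⊗ₜ[k] x') (m ⊗ₜ[k] n) = ρ x m ⊗ₜ[k] σ x' n := rfl

/-- For a linear map `lam : M → H ⊗ M`, `m ↦ m₍₋₁₎ ⊗ m₍₀₎`, and an `H`-module `V`, the map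
`M ⊗ V → V ⊗ M`, `m ⊗ v ↦ m₍₋₁₎·v ⊗ m₍₀₎`. -/
noncomputable def coactBraid {H M V : Type*} [Ring H] [Algebra k H]
    [AddCommGroup M] [Module k M] [AddCommGroup V] [Module k V]
    (lam : M →ₗ[k] H ⊗[k] M) (σ : H →ₐ[k] Module.End k V) : M ⊗[k] V →ₗ[k] V ⊗[k] M :=
  (TensorProduct.lift σ.toLinearMap).rTensor M ∘ₗ
    (TensorProduct.rightComm k H M V).toLinearMap ∘ₗ lam.rTensor V

variable {H : Type*} [Ring H] [Algebra k H]

namespace QuasiBialgebra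

variable (Q : QuasiBialgebra k H)

/-- The tensor product of two `H`-modules: `h · (m ⊗ n) = h₁·m ⊗ h₂·n`. -/
noncomputable def tensorRep {M N : Type*}
    [AddCommGroup M] [Module k M] [AddCommGroup N] [Module k N]
    (ρ : H →ₐ[k] Module.End k M) (σ : H →ₐ[k] Module.End k N) :
    H →ₐ[k] Module.End k (M ⊗[k] N) :=
  (tensorAct ρ σ).comp Q.Δ

/-- The associativity constraint `(m ⊗ n) ⊗ p ↦ X¹·m ⊗ (X²·n ⊗ X³·p)`. -/
noncomputable def associator {M N P : Type*} [AddCommGroup M] [Module k M]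
    [AddCommGroup N] [Module k N] [AddCommGroup P] [Module k P]
    (ρ : H →ₐ[k] Module.End k M) (σ : H →ₐ[k] Module.End k N) (τ : H →ₐ[k] Module.End k P) :
    (M ⊗[k] N) ⊗[k] P →ₗ[k] M ⊗[k] (N ⊗[k] P) :=
  tensorAct ρ (tensorAct σ τ) (Q.Φ : H ⊗[k] (H ⊗[k] H)) ∘ₗ
    (TensorProduct.assoc k M N P).toLinearMap

/-- The inverse constraint `m ⊗ (n ⊗ p) ↦ (x¹·m ⊗ x²·n) ⊗ x³·p`. -/
noncomputable def associatorInv {M N P : Type*} [AddCommGroup M] [Module k M]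
    [AddCommGroup N] [Module k N] [AddCommGroup P] [Module k P]
    (ρ : H →ₐ[k] Module.End k M) (σ : H →ₐ[k] Module.End k N) (τ : H →ₐ[k] Module.End k P) :
    M ⊗[k] (N ⊗[k] P) →ₗ[k] (M ⊗[k] N) ⊗[k] P :=
  (TensorProduct.assoc k M N P).symm.toLinearMap ∘ₗ
    tensorAct ρ (tensorAct σ τ) ((Q.Φ⁻¹ : (H ⊗[k] (H ⊗[k] H))ˣ) : H ⊗[k] (H ⊗[k] H))

/-- The coaction on the tensor product of two Yetter-Drinfeld modules,
`m ⊗ n ↦ X¹ (x¹Y¹·m)₍₋₁₎ x² (Y²·n)₍₋₁₎ Y³ ⊗ X²·(x¹Y¹·m)₍₀₎ ⊗ X³x³·(Y²·n)₍₀₎`.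
The formula is read off the composite
`(M ⊗ N) ⊗ H → M ⊗ (N ⊗ H) → M ⊗ (H ⊗ N) → (M ⊗ H) ⊗ N → (H ⊗ M) ⊗ N → H ⊗ (M ⊗ N)`
at `(m ⊗ n) ⊗ 1`, with `H` the left regular module. -/
noncomputable def tensorCoact {M N : Type*}
    [AddCommGroup M] [Module k M] [AddCommGroup N] [Module k N]
    (ρ : H →ₐ[k] Module.End k M) (lam : M →ₗ[k] H ⊗[k] M)
    (σ : H →ₐ[k] Module.End k N) (mu : N →ₗ[k] H ⊗[k] N) :
    M ⊗[k] N →ₗ[k] H ⊗[k] (M ⊗[k] N) :=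
  Q.associator (Algebra.lmul k H) ρ σ ∘ₗ
    (coactBraid lam (Algebra.lmul k H)).rTensor N ∘ₗ
    Q.associatorInv ρ (Algebra.lmul k H) σ ∘ₗ
    (coactBraid mu (Algebra.lmul k H)).lTensor M ∘ₗ
    Q.associator ρ σ (Algebra.lmul k H) ∘ₗ
    (TensorProduct.mk k (M ⊗[k] N) H).flip 1

/-- The map `(M ⊗ N) ⊗ (M' ⊗ N') → (M ⊗ M') ⊗ (N ⊗ N')` for `M = N = M' = N' = B`, which braids
the two inner factors by `n ⊗ m' ↦ n₍₋₁₎·m' ⊗ n₍₀₎`: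
`(b ⊗ c) ⊗ (b' ⊗ c') ↦ (y¹X¹·b ⊗ y²Y¹(x¹X²·c)₍₋₁₎x²X³₁·b') ⊗
  (y³₁Y²·(x¹X²·c)₍₀₎ ⊗ y³₂Y³x³X³₂·c')`. -/
noncomputable def interchange {B : Type*} [AddCommGroup B] [Module k B]
    (ρ : H →ₐ[k] Module.End k B) (lam : B →ₗ[k] H ⊗[k] B) :
    (B ⊗[k] B) ⊗[k] (B ⊗[k] B) →ₗ[k] (B ⊗[k] B) ⊗[k] (B ⊗[k] B) :=
  Q.associatorInv ρ ρ (Q.tensorRep ρ ρ) ∘ₗ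
    (Q.associator ρ ρ ρ ∘ₗ (coactBraid lam ρ).rTensor B ∘ₗ Q.associatorInv ρ ρ ρ).lTensor B ∘ₗ
    Q.associator ρ ρ (Q.tensorRep ρ ρ)

end QuasiBialgebra

/-- The structure of a left Yetter-Drinfeld module over `Q` on the vector space `M`. -/
structure YDModule (Q : QuasiBialgebra k H) (M : Type*) [AddCommGroup M] [Module k M] where
  /-- the left `H`-action -/
  act : H →ₐ[k] Module.End k M
  /-- the left `H`-coaction `m ↦ m₍₋₁₎ ⊗ m₍₀₎` -/
  coact : M →ₗ[k] H ⊗[k] M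
  /-- `ε(m₍₋₁₎) m₍₀₎ = m` -/
  coact_counit : ∀ m : M,
    TensorProduct.lid k M (Q.ε.toLinearMap.rTensor M (coact m)) = m
  /-- `X¹ m₍₋₁₎ ⊗ (X²·m₍₀₎)₍₋₁₎ X³ ⊗ (X²·m₍₀₎)₍₀₎
    = X¹ (Y¹·m)₍₋₁₎₁ Y² ⊗ X² (Y¹·m)₍₋₁₎₂ Y³ ⊗ X³·(Y¹·m)₍₀₎` -/
  coact_coassoc : ∀ m : M,
    (coactBraid coact (Algebra.lmul k H)).lTensor H
      (Q.associator (Algebra.lmul k H) act (Algebra.lmul k H)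
        ((coactBraid coact (Algebra.lmul k H)).rTensor H ((m ⊗ₜ[k] (1 : H)) ⊗ₜ[k] (1 : H)))) =
    Q.associator (Algebra.lmul k H) (Algebra.lmul k H) act
      (coactBraid coact (Q.tensorRep (Algebra.lmul k H) (Algebra.lmul k H))
        (Q.associator act (Algebra.lmul k H) (Algebra.lmul k H)
          ((m ⊗ₜ[k] (1 : H)) ⊗ₜ[k] (1 : H))))
  /-- `h₁ m₍₋₁₎ ⊗ h₂·m₍₀₎ = (h₁·m)₍₋₁₎ h₂ ⊗ (h₁·m)₍₀₎` -/
  compat : ∀ (h : H) (m : M),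
    Q.tensorRep (Algebra.lmul k H) act h (coact m) =
      coactBraid coact (Algebra.lmul k H)
        (Q.tensorRep act (Algebra.lmul k H) h (m ⊗ₜ[k] (1 : H)))

/-- The structure of a Hopf algebra in the category of left Yetter-Drinfeld modules over `Q`
(a "braided Hopf algebra") on the vector space `B`. -/
structure BraidedHopfAlgebra (Q : QuasiBialgebra k H) (B : Type*)
    [AddCommGroup B] [Module k B] extends YDModule Q B where
  /-- the multiplication -/
  mul : B ⊗[k] B →ₗ[k] B
  /-- the unit -/
  one : B
  /-- the comultiplication -/
  comul : B →ₗ[k] B ⊗[k] B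
  /-- the counit -/
  counit : B →ₗ[k] k
  /-- the antipode -/
  antipode : B →ₗ[k] B
  -- `B` is an algebra in the Yetter-Drinfeld category
  one_mul : ∀ b : B, mul (one ⊗ₜ[k] b) = b
  mul_one : ∀ b : B, mul (b ⊗ₜ[k] one) = b
  act_mul : ∀ (h : H) (t : B ⊗[k] B), act h (mul t) = mul (Q.tensorRep act act h t)
  act_one : ∀ h : H, act h one = Q.ε h • one
  /-- `(b b') b'' = (X¹·b) [(X²·b') (X³·b'')]` -/
  mul_assoc : ∀ t : (B ⊗[k] B) ⊗[k] B,
    mul (mul.rTensor B t) = mul (mul.lTensor B (Q.associator act act act t))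
  coact_mul : ∀ t : B ⊗[k] B,
    coact (mul t) = mul.lTensor H (Q.tensorCoact act coact act coact t)
  coact_one : coact one = (1 : H) ⊗ₜ[k] one
  -- `B` is a coalgebra in the Yetter-Drinfeld category
  comul_act : ∀ (h : H) (b : B), comul (act h b) = Q.tensorRep act act h (comul b)
  counit_act : ∀ (h : H) (b : B), counit (act h b) = Q.ε h * counit b
  counit_comul : ∀ b : B, TensorProduct.lid k B (counit.rTensor B (comul b)) = b
  comul_counit : ∀ b : B, TensorProduct.rid k B (counit.lTensor B (comul b)) = b
  /-- `X¹·b₁₁ ⊗ X²·b₁₂ ⊗ X³·b₂ = b₁ ⊗ b₂₁ ⊗ b₂₂` -/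
  comul_coassoc : ∀ b : B,
    Q.associator act act act (comul.rTensor B (comul b)) = comul.lTensor B (comul b)
  coact_comul : ∀ b : B,
    comul.lTensor H (coact b) = Q.tensorCoact act coact act coact (comul b)
  coact_counit' : ∀ b : B,
    TensorProduct.rid k H (counit.lTensor H (coact b)) = counit b • (1 : H)
  -- the comultiplication and the counit are algebra morphisms
  comul_one : comul one = one ⊗ₜ[k] one
  counit_one : counit one = 1
  counit_mul : ∀ b b' : B, counit (mul (b ⊗ₜ[k] b')) = counit b * counit b'
  comul_mul : ∀ b b' : B,
    comul (mul (b ⊗ₜ[k] b')) =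
      TensorProduct.map mul mul (Q.interchange act coact (comul b ⊗ₜ[k] comul b'))
  -- the antipode is a morphism of Yetter-Drinfeld modules and a convolution inverse of the identity
  antipode_act : ∀ (h : H) (b : B), antipode (act h b) = act h (antipode b)
  antipode_coact : ∀ b : B, coact (antipode b) = antipode.lTensor H (coact b)
  /-- `S(b₁) b₂ = ε(b) 1` -/
  antipode_left : ∀ b : B, mul (antipode.rTensor B (comul b)) = counit b • one
  /-- `b₁ S(b₂) = ε(b) 1` -/
  antipode_right : ∀ b : B, mul (antipode.lTensor B (comul b)) = counit b • one

/-- `B` is trivial if it is isomorphic, as a braided Hopf algebra, to the group Hopf algebra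
`k[C₂]` of the cyclic group of order two, on which `H` acts by `h·x = ε(h) x` and coacts by
`x ↦ 1 ⊗ x`. (An isomorphism of bialgebras automatically commutes with the antipodes.) -/
def BraidedHopfAlgebra.IsTrivial {Q : QuasiBialgebra k H} {B : Type*}
    [AddCommGroup B] [Module k B] (R : BraidedHopfAlgebra Q B) : Prop :=
  ∃ e : MonoidAlgebra k (Multiplicative (ZMod 2)) ≃ₗ[k] B,
    (∀ (h : H) (x : MonoidAlgebra k (Multiplicative (ZMod 2))),
      R.act h (e x) = Q.ε h • e x) ∧
    (∀ x : MonoidAlgebra k (Multiplicative (ZMod 2)), R.coact (e x) = (1 : H) ⊗ₜ[k] e x) ∧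
    (∀ x y : MonoidAlgebra k (Multiplicative (ZMod 2)), R.mul (e x ⊗ₜ[k] e y) = e (x * y)) ∧
    R.one = e 1 ∧
    (∀ x : MonoidAlgebra k (Multiplicative (ZMod 2)),
      R.comul (e x) =
        TensorProduct.map e.toLinearMap e.toLinearMap (Coalgebra.comul (R := k) x)) ∧
    (∀ x : MonoidAlgebra k (Multiplicative (ZMod 2)),
      R.counit (e x) = Coalgebra.counit (R := k) x)

end Representations

/-! ## The quasi-Hopf algebra of functions on a finite group -/

/-- The algebra `k^G` of functions `G → k`, with pointwise operations. -/
def FunAlg (k G : Type*) : Type _ := G → k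

namespace FunAlg

noncomputable instance (k G : Type*) [Field k] : CommRing (FunAlg k G) :=
  inferInstanceAs (CommRing (G → k))

noncomputable instance (k G : Type*) [Field k] : Algebra k (FunAlg k G) :=
  inferInstanceAs (Algebra k (G → k))

variable {k G : Type*} [Field k]

variable (k) in
/-- Evaluation at a point, as a morphism of algebras. -/
noncomputable def ev (x : G) : FunAlg k G →ₐ[k] k := Pi.evalAlgHom k (fun _ : G => k) x

variable (k) in
/-- The indicator function `P_x` of the point `x`. -/
def P [DecidableEq G] (x : G) : FunAlg k G := fun y => if y = x then 1 else 0

/-- A function, seen as an element of `k^G`. -/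
def of (φ : G → k) : FunAlg k G := φ

@[simp] theorem ev_of (x : G) (φ : G → k) : ev k x (of φ) = φ x := rfl

@[simp] theorem ev_P [DecidableEq G] (x y : G) : ev k y (P k x) = if y = x then 1 else 0 := rfl

@[ext] theorem ext {φ ψ : FunAlg k G} (h : ∀ x, ev k x φ = ev k x ψ) : φ = ψ := funext h

theorem expand [Fintype G] [DecidableEq G] (φ : FunAlg k G) :
    φ = ∑ x : G, ev k x φ • P k x := by
  ext y
  simp [map_sum]

end FunAlg

section Functions

variable {k : Type*} [Field k]

section Cocycles

variable {G : Type*} [Group G]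

/-- Normalized `3`-cocycles on `G` with values in `kˣ` (trivial action). -/
structure IsNormalizedThreeCocycle (ω : G → G → G → kˣ) : Prop where
  one_left : ∀ x y, ω 1 x y = 1
  one_mid : ∀ x y, ω x 1 y = 1
  one_right : ∀ x y, ω x y 1 = 1
  cocycle : ∀ x y z t,
    ω y z t * ω x (y * z) t * ω x y z = ω x y (z * t) * ω (x * y) z t

end Cocycles

section Separation

variable {A B : Type*} [Ring A] [Algebra k A] [Ring B] [Algebra k B]

theorem productMap_map {A' B' : Type*} [Ring A'] [Algebra k A'] [Ring B'] [Algebra k B']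
    (f : A' →ₐ[k] k) (g : B' →ₐ[k] k) (φ : A →ₐ[k] A') (ψ : B →ₐ[k] B') (t : A ⊗[k] B) :
    Algebra.TensorProduct.productMap f g (Algebra.TensorProduct.map φ ψ t) =
      Algebra.TensorProduct.productMap (f.comp φ) (g.comp ψ) t := by
  induction t with
  | zero => simp
  | add x y hx hy => simp only [map_add, hx, hy]
  | tmul a b => simp

theorem productMap_assoc {C : Type*} [Ring C] [Algebra k C]
    (f : A →ₐ[k] k) (g : B →ₐ[k] k) (h : C →ₐ[k] k) (t : (A ⊗[k] B) ⊗[k] C) :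
    Algebra.TensorProduct.productMap f (Algebra.TensorProduct.productMap g h)
        (Algebra.TensorProduct.assoc k k k A B C t) =
      Algebra.TensorProduct.productMap (Algebra.TensorProduct.productMap f g) h t := by
  induction t with
  | zero => simp
  | add x y hx hy => simp only [map_add, hx, hy]
  | tmul ab c =>
    induction ab with
    | zero => simp
    | add x y hx hy => simp only [TensorProduct.add_tmul, map_add, hx, hy]
    | tmul a b => simp [mul_assoc]

theorem productMap_lid (g : B →ₐ[k] k) (f : A →ₐ[k] k) (t : A ⊗[k] B) :
    g (Algebra.TensorProduct.lid k B (Algebra.TensorProduct.map f (AlgHom.id k B) t)) =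
      Algebra.TensorProduct.productMap f g t := by
  induction t with
  | zero => simp
  | add x y hx hy => simp only [map_add, hx, hy]
  | tmul a b => simp

theorem productMap_rid (g : B →ₐ[k] k) (f : A →ₐ[k] k) (t : A ⊗[k] B) :
    f (Algebra.TensorProduct.rid k k A (Algebra.TensorProduct.map (AlgHom.id k A) g t)) =
      Algebra.TensorProduct.productMap f g t := by
  induction t with
  | zero => simp
  | add x y hx hy => simp only [map_add, hx, hy]
  | tmul a b => simp [mul_comm]

variable {G : Type*} [Fintype G] [DecidableEq G]

theorem functions_tensor_expand (t : FunAlg k G ⊗[k] B) :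
    t = ∑ x : G, FunAlg.P k x ⊗ₜ[k]
      Algebra.TensorProduct.lid k B (Algebra.TensorProduct.map
        (FunAlg.ev k x) (AlgHom.id k B) t) := by
  induction t with
  | zero => simp
  | add x y hx hy =>
    simp only [map_add, TensorProduct.tmul_add, Finset.sum_add_distrib]
    rw [← hx, ← hy]
  | tmul a b =>
    conv_lhs => rw [FunAlg.expand a, TensorProduct.sum_tmul]
    refine Finset.sum_congr rfl fun x _ => ?_
    simp [TensorProduct.smul_tmul]

theorem functions_tensor_ext {ι : Type*} (F : ι → B →ₐ[k] k)
    (hF : ∀ b b' : B, (∀ i, F i b = F i b') → b = b') (t t' : FunAlg k G ⊗[k] B)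
    (h : ∀ x i, Algebra.TensorProduct.productMap (FunAlg.ev k x) (F i) t =
      Algebra.TensorProduct.productMap (FunAlg.ev k x) (F i) t') :
    t = t' := by
  rw [functions_tensor_expand t, functions_tensor_expand t']
  refine Finset.sum_congr rfl fun x _ => ?_
  congr 1
  refine hF _ _ fun i => ?_
  rw [productMap_lid, productMap_lid, h]

end Separation

section Evaluation

variable (k) {G : Type*}

/-- Evaluation of a two-fold tensor at a pair of points. -/
noncomputable def fev2 (x y : G) : FunAlg k G ⊗[k] FunAlg k G →ₐ[k] k :=
  Algebra.TensorProduct.productMap (FunAlg.ev k x) (FunAlg.ev k y)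

/-- Evaluation of a three-fold tensor at a triple of points. -/
noncomputable def fev3 (x y z : G) :
    FunAlg k G ⊗[k] (FunAlg k G ⊗[k] FunAlg k G) →ₐ[k] k :=
  Algebra.TensorProduct.productMap (FunAlg.ev k x) (fev2 k y z)

/-- Evaluation of a four-fold tensor at a quadruple of points. -/
noncomputable def fev4 (x y z t : G) :
    FunAlg k G ⊗[k] (FunAlg k G ⊗[k] (FunAlg k G ⊗[k] FunAlg k G)) →ₐ[k] k :=
  Algebra.TensorProduct.productMap (FunAlg.ev k x) (fev3 k y z t)

variable {k} [Fintype G] [DecidableEq G]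

theorem fev2_ext (t t' : FunAlg k G ⊗[k] FunAlg k G)
    (h : ∀ x y, fev2 k x y t = fev2 k x y t') : t = t' :=
  functions_tensor_ext (FunAlg.ev k) (fun _ _ => FunAlg.ext) t t' h

theorem fev3_ext (t t' : FunAlg k G ⊗[k] (FunAlg k G ⊗[k] FunAlg k G))
    (h : ∀ x y z, fev3 k x y z t = fev3 k x y z t') : t = t' :=
  functions_tensor_ext (fun p : G × G => fev2 k p.1 p.2)
    (fun b b' hb => fev2_ext b b' fun x y => hb (x, y)) t t' fun x p => h x p.1 p.2

theorem fev4_ext (t t' : FunAlg k G ⊗[k] (FunAlg k G ⊗[k] (FunAlg k G ⊗[k] FunAlg k G)))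
    (h : ∀ x y z w, fev4 k x y z w t = fev4 k x y z w t') : t = t' :=
  functions_tensor_ext (fun p : G × G × G => fev3 k p.1 p.2.1 p.2.2)
    (fun b b' hb => fev3_ext b b' fun x y z => hb (x, y, z)) t t'
    fun x p => h x p.1 p.2.1 p.2.2

end Evaluation

section QuasiBialgebraOfFunctions

variable {G : Type*} [Group G] [Fintype G] [DecidableEq G]

variable (k G) in
/-- The comultiplication of the algebra of functions as a linear map:
`Δ(φ) = ∑ φ(xy) P_x ⊗ P_y`; in particular `Δ(P_g) = ∑_{xy = g} P_x ⊗ P_y`. -/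
noncomputable def functionComulLin : FunAlg k G →ₗ[k] FunAlg k G ⊗[k] FunAlg k G :=
  ∑ x : G, ∑ y : G, (FunAlg.ev k (x * y)).toLinearMap.smulRight
    (FunAlg.P k x ⊗ₜ[k] FunAlg.P k y)

theorem functionComulLin_apply (φ : FunAlg k G) :
    functionComulLin k G φ =
      ∑ x : G, ∑ y : G, FunAlg.ev k (x * y) φ • (FunAlg.P k x ⊗ₜ[k] FunAlg.P k y) := by
  simp [functionComulLin, LinearMap.sum_apply]

theorem fev2_functionComulLin (x y : G) (φ : FunAlg k G) :
    fev2 k x y (functionComulLin k G φ) = FunAlg.ev k (x * y) φ := by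
  simp [functionComulLin_apply, fev2, map_sum]

variable (k G) in
/-- The comultiplication of the algebra of functions on `G`. -/
noncomputable def functionComul : FunAlg k G →ₐ[k] FunAlg k G ⊗[k] FunAlg k G :=
  AlgHom.ofLinearMap (functionComulLin k G)
    (fev2_ext _ _ fun x y => by rw [fev2_functionComulLin, map_one, map_one])
    (fun φ ψ => fev2_ext _ _ fun x y => by
      rw [_root_.map_mul (fev2 k x y), fev2_functionComulLin, fev2_functionComulLin, fev2_functionComulLin,
        _root_.map_mul (FunAlg.ev k (x * y))])

theorem functionComul_apply (φ : FunAlg k G) :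
    functionComul k G φ =
      ∑ x : G, ∑ y : G, FunAlg.ev k (x * y) φ • (FunAlg.P k x ⊗ₜ[k] FunAlg.P k y) :=
  functionComulLin_apply φ

theorem productMap_comp_functionComul (x y : G) :
    (Algebra.TensorProduct.productMap (FunAlg.ev k x) (FunAlg.ev k y)).comp
      (functionComul k G) = FunAlg.ev k (x * y) :=
  AlgHom.ext fun φ => fev2_functionComulLin x y φ

/-- `∑ ω(x, y, z) P_x ⊗ P_y ⊗ P_z`. -/
noncomputable def functionTensor (ω : G → G → G → k) :
    FunAlg k G ⊗[k] (FunAlg k G ⊗[k] FunAlg k G) :=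
  ∑ x : G, ∑ y : G, ∑ z : G,
    ω x y z • (FunAlg.P k x ⊗ₜ[k] (FunAlg.P k y ⊗ₜ[k] FunAlg.P k z))

set_option linter.unusedSectionVars false in
theorem fev3_functionTensor (ω : G → G → G → k) (x y z : G) :
    fev3 k x y z (functionTensor ω) = ω x y z := by
  simp [functionTensor, fev3, fev2, map_sum]

/-- The reassociator `Φ_ω = ∑ ω(x, y, z) P_x ⊗ P_y ⊗ P_z`. -/
noncomputable def functionReassociator (ω : G → G → G → kˣ) :
    (FunAlg k G ⊗[k] (FunAlg k G ⊗[k] FunAlg k G))ˣ where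
  val := functionTensor fun x y z => (ω x y z : k)
  inv := functionTensor fun x y z => ((ω x y z)⁻¹ : kˣ)
  val_inv := fev3_ext _ _ fun x y z => by
    rw [map_mul, fev3_functionTensor, fev3_functionTensor, map_one, Units.mul_inv]
  inv_val := fev3_ext _ _ fun x y z => by
    rw [map_mul, fev3_functionTensor, fev3_functionTensor, map_one, Units.inv_mul]

theorem fev3_functionReassociator (ω : G → G → G → kˣ) (x y z : G) :
    fev3 k x y z (functionReassociator ω : FunAlg k G ⊗[k] (FunAlg k G ⊗[k] FunAlg k G)) =
      ω x y z :=
  fev3_functionTensor _ x y z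

theorem fev3_functionReassociator_inv (ω : G → G → G → kˣ) (x y z : G) :
    fev3 k x y z (((functionReassociator ω)⁻¹ :
      (FunAlg k G ⊗[k] (FunAlg k G ⊗[k] FunAlg k G))ˣ) :
      FunAlg k G ⊗[k] (FunAlg k G ⊗[k] FunAlg k G)) = ((ω x y z)⁻¹ : kˣ) :=
  fev3_functionTensor _ x y z

/-- The quasi-bialgebra `k^G_ω = (k^G, Φ_ω)`. -/
noncomputable def functionQuasiBialgebra (ω : G → G → G → kˣ)
    (hω : IsNormalizedThreeCocycle ω) : QuasiBialgebra k (FunAlg k G) where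
  Δ := functionComul k G
  ε := FunAlg.ev k 1
  Φ := functionReassociator ω
  quasi_coassoc h := fev3_ext _ _ fun x y z => by
    have e1 : fev3 k x y z (Algebra.TensorProduct.map (AlgHom.id k (FunAlg k G))
        (functionComul k G) (functionComul k G h)) = FunAlg.ev k (x * (y * z)) h := by
      rw [fev3, productMap_map, fev2, productMap_comp_functionComul, AlgHom.comp_id]
      exact fev2_functionComulLin x (y * z) h
    have e2 : fev3 k x y z (Algebra.TensorProduct.assoc k k k _ _ _
        (Algebra.TensorProduct.map (functionComul k G) (AlgHom.id k (FunAlg k G))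
          (functionComul k G h))) = FunAlg.ev k (x * y * z) h := by
      rw [fev3, fev2, productMap_assoc, productMap_map, productMap_comp_functionComul,
        AlgHom.comp_id]
      exact fev2_functionComulLin (x * y) z h
    rw [map_mul, map_mul, e1, e2, fev3_functionReassociator, fev3_functionReassociator_inv,
      mul_assoc x y z, mul_right_comm, Units.mul_inv, one_mul]
  counit_right h := by
    ext x
    rw [productMap_rid]
    exact (fev2_functionComulLin x 1 h).trans (by rw [mul_one])
  counit_left h := by
    ext x
    rw [productMap_lid]
    exact (fev2_functionComulLin 1 x h).trans (by rw [one_mul])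
  normalized := fev2_ext _ _ fun x y => by
    have e : (FunAlg.ev k y).comp ((Algebra.TensorProduct.lid k (FunAlg k G)).toAlgHom.comp
        (Algebra.TensorProduct.map (FunAlg.ev k (1 : G)) (AlgHom.id k (FunAlg k G)))) =
        fev2 k 1 y := AlgHom.ext fun t => productMap_lid (FunAlg.ev k y) (FunAlg.ev k 1) t
    rw [fev2, productMap_map, e, AlgHom.comp_id, map_one]
    exact (fev3_functionReassociator ω x 1 y).trans (by rw [hω.one_mid, Units.val_one])
  cocycle := fev4_ext _ _ fun x y z t => by
    have e1 : fev4 k x y z t ((1 : FunAlg k G) ⊗ₜ[k]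
        (functionReassociator ω : FunAlg k G ⊗[k] (FunAlg k G ⊗[k] FunAlg k G))) = ω y z t := by
      rw [fev4, Algebra.TensorProduct.productMap_apply_tmul, map_one, one_mul,
        fev3_functionReassociator]
    have e2 : fev4 k x y z t (Algebra.TensorProduct.map (AlgHom.id k (FunAlg k G))
        ((Algebra.TensorProduct.assoc k k k _ _ _).toAlgHom.comp
          (Algebra.TensorProduct.map (functionComul k G) (AlgHom.id k (FunAlg k G))))
        (functionReassociator ω : FunAlg k G ⊗[k] (FunAlg k G ⊗[k] FunAlg k G))) =
        ω x (y * z) t := by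
      have e : (fev3 k y z t).comp ((Algebra.TensorProduct.assoc k k k _ _ _).toAlgHom.comp
          (Algebra.TensorProduct.map (functionComul k G) (AlgHom.id k (FunAlg k G)))) =
          fev2 k (y * z) t := AlgHom.ext fun s => by
        refine (productMap_assoc _ _ _ _).trans ((productMap_map _ _ _ _ _).trans ?_)
        rw [productMap_comp_functionComul, AlgHom.comp_id]
        rfl
      rw [fev4, productMap_map, e, AlgHom.comp_id]
      exact fev3_functionReassociator ω x (y * z) t
    have e3 : fev4 k x y z t (Algebra.TensorProduct.map (AlgHom.id k (FunAlg k G))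
        (Algebra.TensorProduct.assoc k k k _ _ _).toAlgHom
        (Algebra.TensorProduct.assoc k k k (FunAlg k G) (FunAlg k G ⊗[k] FunAlg k G)
          (FunAlg k G)
          ((functionReassociator ω : FunAlg k G ⊗[k] (FunAlg k G ⊗[k] FunAlg k G)) ⊗ₜ[k]
            (1 : FunAlg k G)))) = ω x y z := by
      have e : (fev3 k y z t).comp (Algebra.TensorProduct.assoc k k k _ _ _).toAlgHom =
          Algebra.TensorProduct.productMap (fev2 k y z) (FunAlg.ev k t) :=
        AlgHom.ext fun s => productMap_assoc _ _ _ s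
      rw [fev4, productMap_map, e, AlgHom.comp_id, productMap_assoc,
        Algebra.TensorProduct.productMap_apply_tmul, map_one, mul_one]
      exact fev3_functionReassociator ω x y z
    have e4 : fev4 k x y z t (Algebra.TensorProduct.map (AlgHom.id k (FunAlg k G))
        (Algebra.TensorProduct.map (AlgHom.id k (FunAlg k G)) (functionComul k G))
        (functionReassociator ω : FunAlg k G ⊗[k] (FunAlg k G ⊗[k] FunAlg k G))) =
        ω x y (z * t) := by
      have e : (fev3 k y z t).comp (Algebra.TensorProduct.map (AlgHom.id k (FunAlg k G))
          (functionComul k G)) = fev2 k y (z * t) := AlgHom.ext fun s => by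
        refine (productMap_map _ _ _ _ _).trans ?_
        rw [fev2, productMap_comp_functionComul, AlgHom.comp_id]
        rfl
      rw [fev4, productMap_map, e, AlgHom.comp_id]
      exact fev3_functionReassociator ω x y (z * t)
    have e5 : fev4 k x y z t (Algebra.TensorProduct.assoc k k k _ _ _
        (Algebra.TensorProduct.map (functionComul k G)
          (AlgHom.id k (FunAlg k G ⊗[k] FunAlg k G))
          (functionReassociator ω : FunAlg k G ⊗[k] (FunAlg k G ⊗[k] FunAlg k G)))) =
        ω (x * y) z t := by
      rw [fev4, fev3, productMap_assoc, productMap_map, productMap_comp_functionComul,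
        AlgHom.comp_id]
      exact fev3_functionReassociator ω (x * y) z t
    rw [map_mul, map_mul, map_mul, e1, e2, e3, e4, e5]
    exact_mod_cast congrArg Units.val (hω.cocycle x y z t)

variable (k G) in
/-- The linear map `S` with `S(P_g) = P_{g⁻¹}`, that is `S(φ)(g) = φ(g⁻¹)`. -/
noncomputable def functionAntipode : FunAlg k G →ₗ[k] FunAlg k G where
  toFun φ := FunAlg.of fun g => FunAlg.ev k g⁻¹ φ
  map_add' _ _ := FunAlg.ext fun _ => by simp
  map_smul' _ _ := FunAlg.ext fun _ => by simp

set_option linter.unusedSectionVars false in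
@[simp] theorem ev_functionAntipode (g : G) (φ : FunAlg k G) :
    FunAlg.ev k g (functionAntipode k G φ) = FunAlg.ev k g⁻¹ φ := rfl

/-- The quasi-Hopf algebra `k^G_ω`, with antipode given by `S(P_g) = P_{g⁻¹}`, `α = 1` and
`β(g) = ω(g, g⁻¹, g)⁻¹`. -/
noncomputable def functionQuasiHopfAlgebra (ω : G → G → G → kˣ)
    (hω : IsNormalizedThreeCocycle ω) : QuasiHopfAlgebra k (FunAlg k G) where
  toQuasiBialgebra := functionQuasiBialgebra ω hω
  S := functionAntipode k G
  S_one := by ext x; simp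
  S_mul a b := by ext x; simp [mul_comm]
  α := 1
  β := FunAlg.of fun g => ((ω g g⁻¹ g)⁻¹ : kˣ)
  antipode_left h := by
    change LinearMap.mul' k _ (TensorProduct.map _ _ (functionComul k G h)) = _
    ext g
    simp [functionComul_apply, map_sum, functionQuasiBialgebra]
  antipode_right h := by
    change LinearMap.mul' k _ (TensorProduct.map _ _ (functionComul k G h)) = _
    ext g
    simp [functionComul_apply, map_sum, functionQuasiBialgebra]
  antipode_reassociator := by
    change LinearMap.mul' k _ (TensorProduct.map _ _ (functionTensor _)) = _
    ext g
    simp [functionTensor, map_sum]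
  antipode_reassociator_inv := by
    change LinearMap.mul' k _ (TensorProduct.map _ _ (functionTensor _)) = _
    ext g
    simp [functionTensor, map_sum]
    have h := hω.cocycle g g⁻¹ g g⁻¹
    simp only [inv_mul_cancel, mul_inv_cancel, hω.one_left, hω.one_mid, hω.one_right,
      mul_one] at h
    rw [← mul_inv, ← Units.val_mul, h, Units.val_one, inv_one]

end QuasiBialgebraOfFunctions

end Functions

/-! ## The double dihedral group and its cocycles -/

section DoubleDihedral

/-- For `m ≥ 1`, the unique integer `r` with `r ≡ x` modulo `2 m` and `-m + 1 ≤ r ≤ m`. -/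
def balancedRem (m : ℕ) (x : ℤ) : ℤ := ((x : ℤ) : ZMod (2 * m)).valMinAbs

namespace QuaternionGroup

variable {n : ℕ}

/-- The exponent `A ∈ {0, 1}` in the normal form `X ^ A * R ^ a`, where `R = a 1`, `X = xa 0`. -/
def expX : QuaternionGroup n → ℕ
  | a _ => 0
  | xa _ => 1

/-- The exponent `a ∈ {-n + 1, …, n}` in the normal form `X ^ A * R ^ a`. -/
def expR : QuaternionGroup n → ℤ
  | a i => i.valMinAbs
  | xa i => i.valMinAbs

theorem normalForm (g : QuaternionGroup n) : g = xa 0 ^ expX g * a 1 ^ expR g := by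
  have h : ∀ j : ℤ, (a 1 : QuaternionGroup n) ^ j = a (j : ZMod (2 * n)) := by
    have h1 : ∀ m : ℕ, (a 1 : QuaternionGroup n) ^ m = a (m : ZMod (2 * n)) := a_one_pow
    intro j
    obtain ⟨m, rfl | rfl⟩ := j.eq_nat_or_neg
    · rw [zpow_natCast, h1, Int.cast_natCast]
    · rw [zpow_neg, zpow_natCast, h1, Int.cast_neg, Int.cast_natCast]
      rfl
  cases g <;> simp [expX, expR, h]

theorem expX_mul (x y : QuaternionGroup n) :
    (expX (x * y) : ℤ) = expX x + expX y - 2 * expX x * expX y := by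
  cases x <;> cases y <;> simp [expX]

theorem expX_cases (x : QuaternionGroup n) : expX x = 0 ∨ expX x = 1 := by
  cases x <;> simp [expX]

theorem expR_mul_eq_balancedRem (x y : QuaternionGroup n) :
    balancedRem n ((-1) ^ expX y * expR x + expR y + n * expX x * expX y) = expR (x * y) := by
  cases x <;> cases y <;> simp [expX, expR, balancedRem] <;> ring_nf

theorem expR_mul (x y : QuaternionGroup n) :
    ∃ q : ℤ, expR (x * y) =
      (-1) ^ expX y * expR x + expR y + n * expX x * expX y - 2 * n * q := by
  rw [← expR_mul_eq_balancedRem]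
  generalize (-1 : ℤ) ^ expX y * expR x + expR y + n * expX x * expX y = m
  have h : ((m - balancedRem n m : ℤ) : ZMod (2 * n)) = 0 := by
    simp [balancedRem]
  obtain ⟨q, hq⟩ := (ZMod.intCast_zmod_eq_zero_iff_dvd _ _).1 h
  exact ⟨q, by push_cast at hq; linarith⟩

end QuaternionGroup

open QuaternionGroup in
/-- The function
`ω_p(X^A R^a, X^B R^b, X^C R^c)
  = ξ ^ (p ((-1)^(B+C) a ((-1)^C b + c - ⟨(-1)^C b + c + n B C⟩))) * ξ₄ ^ (- p A B C)`,
with `⟨x⟩ = balancedRem n x`. -/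
def dihedralCocycle {k : Type*} [Field k] (n : ℕ) (ξ ξ₄ : kˣ) (p : ℕ)
    (x y z : QuaternionGroup n) : kˣ :=
  ξ ^ ((p : ℤ) * ((-1) ^ (expX y + expX z) * expR x *
      ((-1) ^ expX z * expR y + expR z -
        balancedRem n ((-1) ^ expX z * expR y + expR z + n * expX y * expX z)))) *
    ξ₄ ^ (-((p : ℤ) * expX x * expX y * expX z))

section CocycleProof

variable {n : ℕ}

open QuaternionGroup

/-- The exponent of `ξ` in `ω_1`. -/
def cocExp (x y z : QuaternionGroup n) : ℤ :=
  (-1) ^ (expX y + expX z) * expR x *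
    ((-1) ^ expX z * expR y + expR z - expR (y * z))

theorem cocExp_cocycle (x y z t : QuaternionGroup n) :
    ∃ m : ℤ, cocExp y z t + cocExp x (y * z) t + cocExp x y z =
      cocExp x y (z * t) + cocExp (x * y) z t +
        n ^ 2 * (expX x * expX y * expX z * expX t) + 2 * n ^ 2 * m := by
  obtain ⟨q, hq⟩ := expR_mul x y
  obtain ⟨r, hr⟩ := expR_mul z t
  have hs : ∀ u v : QuaternionGroup n,
      (-1 : ℤ) ^ expX (u * v) = (-1) ^ expX u * (-1) ^ expX v := by
    intro u v
    cases u <;> cases v <;> simp [expX]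
  have hz : ((-1 : ℤ) ^ expX z) ^ 2 = 1 := by rw [← pow_mul, mul_comm, pow_mul]; simp
  have ht : ((-1 : ℤ) ^ expX t) ^ 2 = 1 := by rw [← pow_mul, mul_comm, pow_mul]; simp
  have hzt : (-1 : ℤ) ^ expX z * (-1) ^ expX t * (expX z * expX t) = expX z * expX t := by
    rcases expX_cases z with h | h <;> rcases expX_cases t with h' | h' <;> simp [h, h']
  refine ⟨(-1) ^ expX z * (-1) ^ expX t *
    (2 * q * r - expX x * expX y * r - expX z * expX t * q), ?_⟩
  simp only [cocExp, pow_add, hs, mul_assoc y z t]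
  have e1 : cocExp y z t + cocExp x (y * z) t + cocExp x y z -
      cocExp x y (z * t) - cocExp (x * y) z t =
      (-1) ^ expX z * (-1) ^ expX t * ((-1) ^ expX y * expR x + expR y - expR (x * y)) *
        ((-1) ^ expX t * expR z + expR t - expR (z * t)) := by
    simp only [cocExp, pow_add, hs, mul_assoc y z t]
    generalize (-1 : ℤ) ^ expX z = s at *
    generalize (-1 : ℤ) ^ expX t = s' at *
    generalize (-1 : ℤ) ^ expX y = s'' at *
    linear_combination (s'' * expR x * expR y - s'' * expR x * expR y * s' ^ 2) * hz +
      (s'' * s * expR x * expR (y * z) - s'' * s * expR x * expR z - s'' * expR x * expR y) * ht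
  simp only [cocExp, pow_add, hs, mul_assoc y z t] at e1
  rw [hq, hr] at e1 ⊢
  linear_combination e1 + n ^ 2 * expX x * expX y * hzt

end CocycleProof

open QuaternionGroup in
theorem dihedralCocycle_isNormalizedThreeCocycle {k : Type*} [Field k] (n : ℕ) (ξ ξ₄ : kˣ)
    (hξ : ξ ^ (2 * n ^ 2) = 1) (h4 : ξ₄ ^ 2 = ξ ^ (n ^ 2)) (p : ℕ) :
    IsNormalizedThreeCocycle (dihedralCocycle n ξ ξ₄ p) := by
  have key : ∀ x y z : QuaternionGroup n, dihedralCocycle n ξ ξ₄ p x y z =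
      (ξ ^ cocExp x y z * ξ₄ ^ (-(expX x * expX y * expX z : ℤ))) ^ p := by
    intro x y z
    rw [dihedralCocycle, expR_mul_eq_balancedRem, mul_pow, ← zpow_natCast, ← zpow_natCast,
      ← zpow_mul, ← zpow_mul, cocExp]
    congr 2 <;> ring
  have hX1 : expX (1 : QuaternionGroup n) = 0 := rfl
  have hR1 : expR (1 : QuaternionGroup n) = 0 := ZMod.valMinAbs_zero (2 * n)
  refine ⟨fun x y => ?_, fun x y => ?_, fun x y => ?_, fun x y z t => ?_⟩
  · rw [key]
    simp [cocExp, hX1, hR1]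
  · rw [key]
    simp [cocExp, hX1, hR1]
  · rw [key]
    simp [cocExp, hX1, hR1]
  · simp only [key, ← mul_pow]
    congr 1
    obtain ⟨m, hm⟩ := cocExp_cocycle x y z t
    have hX : (expX y * expX z * expX t + expX x * expX (y * z) * expX t +
        expX x * expX y * expX z : ℤ) = expX x * expX y * expX (z * t) +
          expX (x * y) * expX z * expX t + 2 * (expX x * expX y * expX z * expX t) := by
      rw [expX_mul, expX_mul, expX_mul]
      ring
    have hF : -(expX y * expX z * expX t : ℤ) + -(expX x * expX (y * z) * expX t : ℤ) +
        -(expX x * expX y * expX z : ℤ) = -(expX x * expX y * expX (z * t) : ℤ) +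
          -(expX (x * y) * expX z * expX t : ℤ) +
          2 * -(expX x * expX y * expX z * expX t : ℤ) := by
      linear_combination -hX
    have hξ' : ξ ^ (2 * n ^ 2 * m : ℤ) = 1 := by
      rw [zpow_mul]
      exact_mod_cast (congrArg (· ^ m) hξ).trans (one_zpow m)
    have h4' : ∀ j : ℤ, ξ ^ (n ^ 2 * j : ℤ) * ξ₄ ^ (2 * -j : ℤ) = 1 := by
      intro j
      have e : ξ ^ (n ^ 2 : ℤ) = ξ₄ ^ (2 : ℤ) := by exact_mod_cast h4.symm
      rw [zpow_mul, e, zpow_mul, zpow_neg, mul_inv_cancel]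
    calc _ = ξ ^ (cocExp y z t + cocExp x (y * z) t + cocExp x y z) *
          ξ₄ ^ (-(expX y * expX z * expX t : ℤ) + -(expX x * expX (y * z) * expX t : ℤ) +
            -(expX x * expX y * expX z : ℤ)) := by
          simp only [zpow_add]
          ac_rfl
      _ = (ξ ^ cocExp x y (z * t) * ξ₄ ^ (-(expX x * expX y * expX (z * t) : ℤ))) *
          (ξ ^ cocExp (x * y) z t * ξ₄ ^ (-(expX (x * y) * expX z * expX t : ℤ))) *
          (ξ ^ (n ^ 2 * (expX x * expX y * expX z * expX t) : ℤ) *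
            ξ₄ ^ (2 * -(expX x * expX y * expX z * expX t) : ℤ)) *
          ξ ^ (2 * n ^ 2 * m : ℤ) := by
          rw [hm, hF]
          simp only [zpow_add]
          ac_rfl
      _ = _ := by rw [h4', hξ', mul_one, mul_one]

end DoubleDihedral

/-! ### Structure maps of the Yetter–Drinfeld category evaluated on weight vectors. -/

section WeightVectors

variable {k : Type*} [Field k]

/-! An action of `k^G` is a `G`-grading, so on homogeneous vectors every associator is
multiplication by a value of `ω`. If moreover the coaction is diagonal, `b ↦ χ ⊗ b`, every braiding
is multiplication by a value of `χ`, and each axiom becomes an identity between scalars.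

Let `B` have dimension 2. The kernel of the counit is a line, spanned by a homogeneous `b` of some
weight `d`, and colinearity of the counit makes the coaction on it diagonal (`exists_basis`,
`exists_structure`). Coassociativity says that `χ` is a character twisted by `d`, that is `χ(g) χ(h)
ω(g,d,h) = χ(gh) ω(d,g,h) ω(g,h,d)`; hence `χ` vanishes nowhere, and the Yetter–Drinfeld
compatibility makes `d` central (`weight_central_of_coact`). Two cases remain.

If `d = 1`, the braiding and associator are plain. With `b² = γ b` and `t` the coefficient of `b ⊗
b` in the coproduct of `b`, the bialgebra axiom and the antipode give `γ t = -2`; since 2 is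
invertible, `1 + t b` is a grouplike element of order two, and `χ² = χ` gives `χ = 1`. So `B` is
trivial (`isTrivial_of_weight_one`).

If `d ≠ 1`, the grading forces `b² = 0` and `b` primitive, and multiplicativity of the coproduct at
`b²` forces `χ(d) = -1` (`twistedCharacter_weight_eq_neg_one`). Conversely, a twisted character at a
central `z` with `χ(z) = -1` defines a braided exterior algebra on one generator
(`primitiveBraidedHopfAlgebra`).

The only central `d ≠ 1` is `R^n`. There the twist at `(X^A R^a, X^B R^b)` is `ξ^(p B (n² A - 2 n
a))` (`dihedralCocycle_central`). Evaluating at `R X = X R⁻¹` gives `χ(R)² = ξ^(-2np)`, so `χ(R) = ±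
ξ^(-np)` and `χ(R^n) = (±1)^n (-1)^p`. The value `-1` is attained exactly when `p` or `n` is odd,
which is the stated parity condition; a suitable value `χ(X)`, a power of `ξ₄`, always exists. -/

/-- A simultaneous eigenvector for the action of an algebra, with eigenvalues given by the
character `f`. -/
def IsWeightVector {A M : Type*} [Ring A] [Algebra k A] [AddCommGroup M] [Module k M]
    (ρ : A →ₐ[k] Module.End k M) (f : A →ₐ[k] k) (m : M) : Prop :=
  ∀ a : A, ρ a m = f a • m

theorem IsWeightVector.tensorAct {A A' M N : Type*} [Ring A] [Algebra k A] [Ring A']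
    [Algebra k A'] [AddCommGroup M] [Module k M] [AddCommGroup N] [Module k N]
    {ρ : A →ₐ[k] Module.End k M} {σ : A' →ₐ[k] Module.End k N} {f : A →ₐ[k] k}
    {g : A' →ₐ[k] k} {m : M} {n : N} (hm : IsWeightVector ρ f m) (hn : IsWeightVector σ g n) :
    IsWeightVector (tensorAct ρ σ) (Algebra.TensorProduct.productMap f g) (m ⊗ₜ[k] n) := by
  intro t
  induction t with
  | zero => simp
  | add x y hx hy => simp only [map_add, LinearMap.add_apply, hx, hy, add_smul]
  | tmul a b =>
    rw [tensorAct_tmul_tmul, hm, hn, Algebra.TensorProduct.productMap_apply_tmul,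
      TensorProduct.smul_tmul_smul]

theorem coactBraid_of_isWeightVector {H M V : Type*} [Ring H] [Algebra k H]
    [AddCommGroup M] [Module k M] [AddCommGroup V] [Module k V]
    {lam : M →ₗ[k] H ⊗[k] M} {σ : H →ₐ[k] Module.End k V} {f : H →ₐ[k] k} {χ : H}
    {m : M} {v : V} (hm : lam m = χ ⊗ₜ[k] m) (hv : IsWeightVector σ f v) :
    coactBraid lam σ (m ⊗ₜ[k] v) = f χ • (v ⊗ₜ[k] m) := by
  simp [coactBraid, hm, hv χ, TensorProduct.smul_tmul']

theorem FunAlg.one_eq_sum_P {G : Type*} [Fintype G] [DecidableEq G] :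
    (1 : FunAlg k G) = ∑ x : G, FunAlg.P k x := by
  ext y
  simp [map_sum]

theorem FunAlg.mul_P {G : Type*} [DecidableEq G] (h : FunAlg k G) (x : G) :
    h * FunAlg.P k x = FunAlg.ev k x h • FunAlg.P k x := by
  ext y
  by_cases hxy : y = x <;> simp [hxy]

theorem isWeightVector_P {G : Type*} [DecidableEq G] (x : G) :
    IsWeightVector (Algebra.lmul k (FunAlg k G)) (FunAlg.ev k x) (FunAlg.P k x) :=
  fun h => FunAlg.mul_P h x

theorem FunAlg.tmul_eq_sum {G M : Type*} [Fintype G] [DecidableEq G] [AddCommGroup M]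
    [Module k M] (χ : FunAlg k G) (m : M) :
    χ ⊗ₜ[k] m = ∑ x : G, FunAlg.ev k x χ • (FunAlg.P k x ⊗ₜ[k] m) := by
  conv_lhs => rw [FunAlg.expand χ, TensorProduct.sum_tmul]
  rfl

variable {G : Type*} [Group G] [Fintype G] [DecidableEq G]

variable {ω : G → G → G → kˣ} {hω : IsNormalizedThreeCocycle ω}
variable {M N P : Type*} [AddCommGroup M] [Module k M] [AddCommGroup N] [Module k N]
  [AddCommGroup P] [Module k P]
  {ρ : FunAlg k G →ₐ[k] Module.End k M} {σ : FunAlg k G →ₐ[k] Module.End k N}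
  {τ : FunAlg k G →ₐ[k] Module.End k P} {x y z : G} {m : M} {n : N} {q : P}

theorem IsWeightVector.tensorRep (hm : IsWeightVector ρ (FunAlg.ev k x) m)
    (hn : IsWeightVector σ (FunAlg.ev k y) n) :
    IsWeightVector ((functionQuasiBialgebra ω hω).tensorRep ρ σ) (FunAlg.ev k (x * y))
      (m ⊗ₜ[k] n) := by
  intro h
  refine (hm.tensorAct hn _).trans ?_
  congr 1
  exact fev2_functionComulLin x y h

theorem associator_of_isWeightVector (hm : IsWeightVector ρ (FunAlg.ev k x) m)
    (hn : IsWeightVector σ (FunAlg.ev k y) n) (hq : IsWeightVector τ (FunAlg.ev k z) q) :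
    (functionQuasiBialgebra ω hω).associator ρ σ τ ((m ⊗ₜ[k] n) ⊗ₜ[k] q) =
      (ω x y z : k) • (m ⊗ₜ[k] (n ⊗ₜ[k] q)) := by
  refine (hm.tensorAct (hn.tensorAct hq) _).trans ?_
  congr 1
  exact fev3_functionReassociator ω x y z

theorem associatorInv_of_isWeightVector (hm : IsWeightVector ρ (FunAlg.ev k x) m)
    (hn : IsWeightVector σ (FunAlg.ev k y) n) (hq : IsWeightVector τ (FunAlg.ev k z) q) :
    (functionQuasiBialgebra ω hω).associatorInv ρ σ τ (m ⊗ₜ[k] (n ⊗ₜ[k] q)) =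
      (((ω x y z)⁻¹ : kˣ) : k) • ((m ⊗ₜ[k] n) ⊗ₜ[k] q) := by
  refine (congrArg (TensorProduct.assoc k M N P).symm
    ((hm.tensorAct (hn.tensorAct hq) _).trans (congrArg (· • (m ⊗ₜ[k] (n ⊗ₜ[k] q)))
      (fev3_functionReassociator_inv ω x y z)))).trans ?_
  simp

/-- Writing the unit of `k^G` as the sum of the `P_g`, each a weight vector of weight `g` for left
multiplication, turns the five maps composing the coaction into five scalars; these are the five
factors at `g`, in order of application. -/
theorem tensorCoact_of_isWeightVector {lam : M →ₗ[k] FunAlg k G ⊗[k] M}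
    {mu : N →ₗ[k] FunAlg k G ⊗[k] N} {χ ψ : FunAlg k G}
    (hm : IsWeightVector ρ (FunAlg.ev k x) m) (hlam : lam m = χ ⊗ₜ[k] m)
    (hn : IsWeightVector σ (FunAlg.ev k y) n) (hmu : mu n = ψ ⊗ₜ[k] n) :
    (functionQuasiBialgebra ω hω).tensorCoact ρ lam σ mu (m ⊗ₜ[k] n) =
      FunAlg.of (fun g => ω x y g * FunAlg.ev k g ψ * ((ω x g y)⁻¹ : kˣ) * FunAlg.ev k g χ *
        ω g x y) ⊗ₜ[k] (m ⊗ₜ[k] n) := by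
  have h1 : (TensorProduct.mk k (M ⊗[k] N) (FunAlg k G)).flip 1 (m ⊗ₜ[k] n) =
      ∑ g : G, (m ⊗ₜ[k] n) ⊗ₜ[k] FunAlg.P k g := by
    rw [LinearMap.flip_apply, TensorProduct.mk_apply, FunAlg.one_eq_sum_P,
      TensorProduct.tmul_sum]
  simp only [QuasiBialgebra.tensorCoact, LinearMap.comp_apply]
  rw [h1, FunAlg.tmul_eq_sum]
  simp only [map_sum]
  refine Finset.sum_congr rfl fun g _ => ?_
  have hg := isWeightVector_P (k := k) g
  rw [associator_of_isWeightVector hm hn hg, map_smul, LinearMap.lTensor_tmul,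
    coactBraid_of_isWeightVector hmu hg, TensorProduct.tmul_smul]
  simp only [map_smul]
  rw [associatorInv_of_isWeightVector hm hg hn]
  simp only [map_smul]
  rw [LinearMap.rTensor_tmul, coactBraid_of_isWeightVector hlam hg,
    ← TensorProduct.smul_tmul', map_smul, associator_of_isWeightVector hg hm hn]
  simp only [smul_smul, FunAlg.ev_of, mul_assoc]

/-- Only the braiding of `b` past `c` sees the coaction, which is why `χ` is evaluated at the weight
of `c`; the other four factors are rebracketings. -/
theorem interchange_of_isWeightVector {B : Type*} [AddCommGroup B] [Module k B]
    {ρ : FunAlg k G →ₐ[k] Module.End k B} {lam : B →ₗ[k] FunAlg k G ⊗[k] B} {χ : FunAlg k G}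
    {a b c d : B} {x y z w : G}
    (ha : IsWeightVector ρ (FunAlg.ev k x) a) (hb : IsWeightVector ρ (FunAlg.ev k y) b)
    (hc : IsWeightVector ρ (FunAlg.ev k z) c) (hd : IsWeightVector ρ (FunAlg.ev k w) d)
    (hlam : lam b = χ ⊗ₜ[k] b) :
    (functionQuasiBialgebra ω hω).interchange ρ lam ((a ⊗ₜ[k] b) ⊗ₜ[k] (c ⊗ₜ[k] d)) =
      ((ω x y (z * w) : k) * ((ω y z w)⁻¹ : kˣ) * FunAlg.ev k z χ * ω z y w *
        ((ω x z (y * w))⁻¹ : kˣ)) • ((a ⊗ₜ[k] c) ⊗ₜ[k] (b ⊗ₜ[k] d)) := by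
  simp only [QuasiBialgebra.interchange, LinearMap.comp_apply]
  rw [associator_of_isWeightVector ha hb (hc.tensorRep hd)]
  simp only [map_smul]
  rw [LinearMap.lTensor_tmul]
  simp only [LinearMap.comp_apply]
  rw [associatorInv_of_isWeightVector hb hc hd, map_smul, LinearMap.rTensor_tmul,
    coactBraid_of_isWeightVector hlam hc]
  simp only [← TensorProduct.smul_tmul', map_smul]
  rw [associator_of_isWeightVector hc hb hd]
  simp only [TensorProduct.tmul_smul, map_smul]
  rw [associatorInv_of_isWeightVector ha hc (hb.tensorRep hd)]
  simp only [smul_smul, mul_assoc]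

theorem coact_coassoc_lhs {lam : M →ₗ[k] FunAlg k G ⊗[k] M} {χ : FunAlg k G}
    (hm : IsWeightVector ρ (FunAlg.ev k x) m) (hlam : lam m = χ ⊗ₜ[k] m) (g h : G) :
    (coactBraid lam (Algebra.lmul k (FunAlg k G))).lTensor (FunAlg k G)
      ((functionQuasiBialgebra ω hω).associator (Algebra.lmul k (FunAlg k G)) ρ
          (Algebra.lmul k (FunAlg k G))
        ((coactBraid lam (Algebra.lmul k (FunAlg k G))).rTensor (FunAlg k G)
          ((m ⊗ₜ[k] FunAlg.P k g) ⊗ₜ[k] FunAlg.P k h))) =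
      (FunAlg.ev k g χ * ω g x h * FunAlg.ev k h χ) •
        (FunAlg.P k g ⊗ₜ[k] (FunAlg.P k h ⊗ₜ[k] m)) := by
  have hg := isWeightVector_P (k := k) g
  have hh := isWeightVector_P (k := k) h
  rw [LinearMap.rTensor_tmul, coactBraid_of_isWeightVector hlam hg,
    ← TensorProduct.smul_tmul', map_smul, associator_of_isWeightVector hg hm hh]
  simp only [map_smul]
  rw [LinearMap.lTensor_tmul, coactBraid_of_isWeightVector hlam hh, TensorProduct.tmul_smul]
  simp only [smul_smul, mul_assoc]

/-- Here `m` is braided past `P_g ⊗ P_h` in one step, and this vector has weight `g * h`; on the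
other side of coassociativity `m` passes `P_g` and `P_h` separately, which produces the product of
the values at `g` and `h`. -/
theorem coact_coassoc_rhs {lam : M →ₗ[k] FunAlg k G ⊗[k] M} {χ : FunAlg k G}
    (hm : IsWeightVector ρ (FunAlg.ev k x) m) (hlam : lam m = χ ⊗ₜ[k] m) (g h : G) :
    (functionQuasiBialgebra ω hω).associator (Algebra.lmul k (FunAlg k G))
        (Algebra.lmul k (FunAlg k G)) ρ
      (coactBraid lam ((functionQuasiBialgebra ω hω).tensorRep (Algebra.lmul k (FunAlg k G))
          (Algebra.lmul k (FunAlg k G)))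
        ((functionQuasiBialgebra ω hω).associator ρ (Algebra.lmul k (FunAlg k G))
            (Algebra.lmul k (FunAlg k G))
          ((m ⊗ₜ[k] FunAlg.P k g) ⊗ₜ[k] FunAlg.P k h))) =
      (ω x g h * FunAlg.ev k (g * h) χ * ω g h x) •
        (FunAlg.P k g ⊗ₜ[k] (FunAlg.P k h ⊗ₜ[k] m)) := by
  have hg := isWeightVector_P (k := k) g
  have hh := isWeightVector_P (k := k) h
  rw [associator_of_isWeightVector hm hg hh, map_smul,
    coactBraid_of_isWeightVector hlam (hg.tensorRep hh), map_smul, map_smul,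
    associator_of_isWeightVector hg hh hm]
  simp only [smul_smul, mul_assoc]

/-- Separation of the coefficients of the basis elements `P_g ⊗ P_h ⊗ m`. -/
theorem sum_smul_P_tmul_P_tmul_inj {G M : Type*} [Fintype G] [DecidableEq G] [AddCommGroup M]
    [Module k M] {m : M} (hm : m ≠ 0) (c d : G → G → k) :
    ∑ g : G, ∑ h : G, c g h • (FunAlg.P k g ⊗ₜ[k] (FunAlg.P k h ⊗ₜ[k] m)) =
      ∑ g : G, ∑ h : G, d g h • (FunAlg.P k g ⊗ₜ[k] (FunAlg.P k h ⊗ₜ[k] m)) ↔ c = d := by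
  refine ⟨fun H => ?_, fun H => by rw [H]⟩
  funext g h
  have H' := congrArg ((TensorProduct.lid k M).toLinearMap ∘ₗ
    (FunAlg.ev k h).toLinearMap.rTensor M ∘ₗ (TensorProduct.lid k _).toLinearMap ∘ₗ
    (FunAlg.ev k g).toLinearMap.rTensor (FunAlg k G ⊗[k] M)) H
  simp only [map_sum, map_smul, LinearMap.comp_apply, LinearMap.rTensor_tmul,
    AlgHom.toLinearMap_apply, LinearEquiv.coe_coe, TensorProduct.lid_tmul, FunAlg.ev_P] at H'
  simp at H'
  exact smul_left_injective k hm H'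

theorem tmul_one_tmul_one {G M : Type*} [Fintype G] [DecidableEq G] [AddCommGroup M]
    [Module k M] (m : M) : (m ⊗ₜ[k] (1 : FunAlg k G)) ⊗ₜ[k] (1 : FunAlg k G) =
    ∑ g : G, ∑ h : G, (m ⊗ₜ[k] FunAlg.P k g) ⊗ₜ[k] FunAlg.P k h := by
  rw [FunAlg.one_eq_sum_P]
  simp only [TensorProduct.tmul_sum, TensorProduct.sum_tmul]
  exact Finset.sum_comm

/-- Coassociativity of a diagonal coaction `m ↦ χ ⊗ m` on a weight vector, as a twisted
multiplicativity of `χ`. -/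
theorem coact_coassoc_iff {lam : M →ₗ[k] FunAlg k G ⊗[k] M} {χ : FunAlg k G} (hm0 : m ≠ 0)
    (hm : IsWeightVector ρ (FunAlg.ev k x) m) (hlam : lam m = χ ⊗ₜ[k] m) :
    ((coactBraid lam (Algebra.lmul k (FunAlg k G))).lTensor (FunAlg k G)
      ((functionQuasiBialgebra ω hω).associator (Algebra.lmul k (FunAlg k G)) ρ
          (Algebra.lmul k (FunAlg k G))
        ((coactBraid lam (Algebra.lmul k (FunAlg k G))).rTensor (FunAlg k G)
          ((m ⊗ₜ[k] (1 : FunAlg k G)) ⊗ₜ[k] (1 : FunAlg k G)))) =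
    (functionQuasiBialgebra ω hω).associator (Algebra.lmul k (FunAlg k G))
        (Algebra.lmul k (FunAlg k G)) ρ
      (coactBraid lam ((functionQuasiBialgebra ω hω).tensorRep (Algebra.lmul k (FunAlg k G))
          (Algebra.lmul k (FunAlg k G)))
        ((functionQuasiBialgebra ω hω).associator ρ (Algebra.lmul k (FunAlg k G))
            (Algebra.lmul k (FunAlg k G))
          ((m ⊗ₜ[k] (1 : FunAlg k G)) ⊗ₜ[k] (1 : FunAlg k G))))) ↔
    ∀ g h : G, FunAlg.ev k g χ * ω g x h * FunAlg.ev k h χ =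
      ω x g h * FunAlg.ev k (g * h) χ * ω g h x := by
  rw [tmul_one_tmul_one]
  simp only [map_sum]
  simp only [coact_coassoc_lhs hm hlam, coact_coassoc_rhs hm hlam]
  rw [sum_smul_P_tmul_P_tmul_inj hm0]
  simp only [funext_iff]

/-- Compatibility of a diagonal coaction `m ↦ χ ⊗ m` on a weight vector with the action. -/
theorem yd_compat_iff {lam : M →ₗ[k] FunAlg k G ⊗[k] M} {χ : FunAlg k G} (hm0 : m ≠ 0)
    (hm : IsWeightVector ρ (FunAlg.ev k x) m) (hlam : lam m = χ ⊗ₜ[k] m) (h : FunAlg k G) :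
    ((functionQuasiBialgebra ω hω).tensorRep (Algebra.lmul k (FunAlg k G)) ρ h (lam m) =
      coactBraid lam (Algebra.lmul k (FunAlg k G))
        ((functionQuasiBialgebra ω hω).tensorRep ρ (Algebra.lmul k (FunAlg k G)) h
          (m ⊗ₜ[k] (1 : FunAlg k G)))) ↔
    ∀ g : G, FunAlg.ev k g χ * FunAlg.ev k (g * x) h =
      FunAlg.ev k (x * g) h * FunAlg.ev k g χ := by
  -- The two sides act by `h` on `P_g ⊗ m` and on `m ⊗ P_g`, so they differ only in the weights `g *
  -- x` and `x * g`.
  have e1 : (functionQuasiBialgebra ω hω).tensorRep (Algebra.lmul k (FunAlg k G)) ρ h (lam m) =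
      FunAlg.of (fun g => FunAlg.ev k g χ * FunAlg.ev k (g * x) h) ⊗ₜ[k] m := by
    rw [hlam, FunAlg.tmul_eq_sum, FunAlg.tmul_eq_sum, map_sum]
    refine Finset.sum_congr rfl fun g _ => ?_
    rw [map_smul, (isWeightVector_P g).tensorRep hm h, smul_smul, FunAlg.ev_of]
  have e2 : coactBraid lam (Algebra.lmul k (FunAlg k G))
        ((functionQuasiBialgebra ω hω).tensorRep ρ (Algebra.lmul k (FunAlg k G)) h
          (m ⊗ₜ[k] (1 : FunAlg k G))) =
      FunAlg.of (fun g => FunAlg.ev k (x * g) h * FunAlg.ev k g χ) ⊗ₜ[k] m := by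
    rw [FunAlg.one_eq_sum_P, TensorProduct.tmul_sum, FunAlg.tmul_eq_sum, map_sum, map_sum]
    refine Finset.sum_congr rfl fun g _ => ?_
    rw [hm.tensorRep (isWeightVector_P g) h, map_smul,
      coactBraid_of_isWeightVector hlam (isWeightVector_P g), smul_smul, FunAlg.ev_of]
  rw [e1, e2]
  refine ⟨fun H g => ?_, fun H => by rw [funext H]⟩
  have H' := congrArg ((TensorProduct.lid k M).toLinearMap ∘ₗ (FunAlg.ev k g).toLinearMap.rTensor M) H
  simp only [LinearMap.comp_apply, LinearMap.rTensor_tmul, AlgHom.toLinearMap_apply,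
    LinearEquiv.coe_coe, TensorProduct.lid_tmul, FunAlg.ev_of] at H'
  exact smul_left_injective k hm0 H'

end WeightVectors

/-! ### Construction of a braided exterior algebra from a twisted character. -/

section PrimitiveBraidedHopfAlgebra

variable {k : Type*} [Field k] {G : Type*}
variable {B : Type*} [AddCommGroup B] [Module k B]

/-- The action for which the basis vector `e i` has weight `d i`. -/
noncomputable def diagonalAct {ι : Type*} (e : Module.Basis ι k B) (d : ι → G) :
    FunAlg k G →ₐ[k] Module.End k B :=
  AlgHom.ofLinearMap
    { toFun := fun h => e.constr k fun i => FunAlg.ev k (d i) h • e i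
      map_add' := fun h h' => e.ext fun i => by simp [add_smul]
      map_smul' := fun c h => e.ext fun i => by simp [mul_smul] }
    (e.ext fun i => by simp)
    (fun h h' => e.ext fun i => by simp [smul_smul, mul_comm])

theorem diagonalAct_isWeightVector {ι : Type*} (e : Module.Basis ι k B) (d : ι → G) (i : ι) :
    IsWeightVector (diagonalAct e d) (FunAlg.ev k (d i)) (e i) := fun h => by
  simp [diagonalAct]

/-- The coaction `e i ↦ χ i ⊗ e i`. -/
noncomputable def diagonalCoact {ι : Type*} (e : Module.Basis ι k B) (χ : ι → FunAlg k G) :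
    B →ₗ[k] FunAlg k G ⊗[k] B :=
  e.constr k fun i => χ i ⊗ₜ[k] e i

@[simp] theorem diagonalCoact_basis {ι : Type*} (e : Module.Basis ι k B) (χ : ι → FunAlg k G)
    (i : ι) : diagonalCoact e χ (e i) = χ i ⊗ₜ[k] e i := by
  simp [diagonalCoact]

variable (e : Module.Basis (Fin 2) k B)

/-- The multiplication with unit `e 0` and `e 1 * e 1 = 0`. -/
noncomputable def primitiveMul : B ⊗[k] B →ₗ[k] B :=
  (e.tensorProduct e).constr k fun ij => (![![e 0, e 1], ![e 1, 0]] : Fin 2 → Fin 2 → B) ij.1 ij.2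

theorem primitiveMul_basis (i j : Fin 2) : primitiveMul e (e i ⊗ₜ[k] e j) =
    (![![e 0, e 1], ![e 1, 0]] : Fin 2 → Fin 2 → B) i j := by
  rw [← Module.Basis.tensorProduct_apply, primitiveMul, Module.Basis.constr_basis]

/-- The comultiplication with `e 0` grouplike and `e 1` primitive. -/
noncomputable def primitiveComul : B →ₗ[k] B ⊗[k] B :=
  e.constr k ![e 0 ⊗ₜ[k] e 0, e 1 ⊗ₜ[k] e 0 + e 0 ⊗ₜ[k] e 1]

theorem primitiveComul_zero : primitiveComul e (e 0) = e 0 ⊗ₜ[k] e 0 := by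
  simp [primitiveComul]

theorem primitiveComul_one :
    primitiveComul e (e 1) = e 1 ⊗ₜ[k] e 0 + e 0 ⊗ₜ[k] e 1 := by
  simp [primitiveComul]

/-- The counit with `e 0 ↦ 1` and `e 1 ↦ 0`. -/
noncomputable def primitiveCounit : B →ₗ[k] k := e.constr k ![(1 : k), 0]

theorem primitiveCounit_zero : primitiveCounit e (e 0) = 1 := by simp [primitiveCounit]

theorem primitiveCounit_one : primitiveCounit e (e 1) = 0 := by simp [primitiveCounit]

/-- The antipode with `e 0 ↦ e 0` and `e 1 ↦ -e 1`. -/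
noncomputable def primitiveAntipode : B →ₗ[k] B := e.constr k ![e 0, -e 1]

theorem primitiveAntipode_zero : primitiveAntipode e (e 0) = e 0 := by simp [primitiveAntipode]

theorem primitiveAntipode_one : primitiveAntipode e (e 1) = -e 1 := by simp [primitiveAntipode]

variable [Group G] [Fintype G] [DecidableEq G]

variable {ω : G → G → G → kˣ} {hω : IsNormalizedThreeCocycle ω}

theorem Module.Basis.apply_eq_of_forall {ι M : Type*} [AddCommGroup M] [Module k M]
    (e : Module.Basis ι k B) {f g : B →ₗ[k] M} (h : ∀ i, f (e i) = g (e i)) (b : B) :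
    f b = g b :=
  LinearMap.congr_fun (e.ext h) b

theorem Module.Basis.tensor_apply_eq_of_forall {ι M : Type*} [AddCommGroup M] [Module k M]
    (e : Module.Basis ι k B) {f g : B ⊗[k] B →ₗ[k] M}
    (h : ∀ i j, f (e i ⊗ₜ[k] e j) = g (e i ⊗ₜ[k] e j)) (t : B ⊗[k] B) : f t = g t :=
  (e.tensorProduct e).apply_eq_of_forall (fun ij => by
    rw [Module.Basis.tensorProduct_apply']
    exact h ij.1 ij.2) t

theorem Module.Basis.tensor_tensor_apply_eq_of_forall {ι M : Type*} [AddCommGroup M] [Module k M]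
    (e : Module.Basis ι k B) {f g : (B ⊗[k] B) ⊗[k] B →ₗ[k] M}
    (h : ∀ i j l, f ((e i ⊗ₜ[k] e j) ⊗ₜ[k] e l) = g ((e i ⊗ₜ[k] e j) ⊗ₜ[k] e l))
    (t : (B ⊗[k] B) ⊗[k] B) : f t = g t :=
  ((e.tensorProduct e).tensorProduct e).apply_eq_of_forall
    (fun ij => by
    rw [Module.Basis.tensorProduct_apply', Module.Basis.tensorProduct_apply']
    exact h ij.1.1 ij.1.2 ij.2) t

/-- A coaction that is diagonal on a basis of weight vectors, with central weights and twisted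
characters as coefficients, defines a Yetter-Drinfeld module. -/
noncomputable def diagonalYDModule {ι : Type*} (e : Module.Basis ι k B) (d : ι → G)
    (χ : ι → FunAlg k G) (hd : ∀ i g, g * d i = d i * g) (h1 : ∀ i, FunAlg.ev k 1 (χ i) = 1)
    (hχ : ∀ i g h, FunAlg.ev k g (χ i) * ω g (d i) h * FunAlg.ev k h (χ i) =
      ω (d i) g h * FunAlg.ev k (g * h) (χ i) * ω g h (d i)) :
    YDModule (functionQuasiBialgebra ω hω) B where
  act := diagonalAct e d
  coact := diagonalCoact e χ
  coact_counit := e.apply_eq_of_forall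
    (f := (TensorProduct.lid k B).toLinearMap ∘ₗ
      ((functionQuasiBialgebra ω hω).ε.toLinearMap.rTensor B) ∘ₗ diagonalCoact e χ)
    (g := LinearMap.id) fun i => by
      simp only [LinearMap.comp_apply, diagonalCoact_basis, LinearMap.rTensor_tmul,
        AlgHom.toLinearMap_apply, LinearEquiv.coe_coe, TensorProduct.lid_tmul]
      exact (congrArg (· • e i) (h1 i)).trans (one_smul _ _)
  -- Both sides are linear in `m`, so it suffices to treat basis vectors, where the axiom is the
  -- twisted multiplicativity of `χ i`.
  coact_coassoc m := by
    rw [← e.linearCombination_repr m, Finsupp.linearCombination_apply, Finsupp.sum]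
    simp only [TensorProduct.sum_tmul, ← TensorProduct.smul_tmul', map_sum, map_smul]
    refine Finset.sum_congr rfl fun i _ => ?_
    rw [(coact_coassoc_iff (e.ne_zero i) (diagonalAct_isWeightVector e d i)
      (diagonalCoact_basis e χ i)).2 (hχ i)]
  compat h m := by
    rw [← e.linearCombination_repr m, Finsupp.linearCombination_apply, Finsupp.sum]
    simp only [TensorProduct.sum_tmul, ← TensorProduct.smul_tmul', map_sum, map_smul]
    refine Finset.sum_congr rfl fun i _ => ?_
    rw [(yd_compat_iff (e.ne_zero i) (diagonalAct_isWeightVector e d i)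
      (diagonalCoact_basis e χ i) h).2 fun g => by rw [hd, mul_comm]]

set_option maxHeartbeats 800000 in
/-- The braided Hopf algebra with basis `1, e 1` where `e 1` is primitive, squares to zero, and
has central weight `z` and coaction `χ ⊗ e 1` with `χ z = -1`. -/
noncomputable def primitiveBraidedHopfAlgebra (z : G) (χ : FunAlg k G) (hz : ∀ g, g * z = z * g)
    (h1 : FunAlg.ev k 1 χ = 1)
    (hχ : ∀ g h, FunAlg.ev k g χ * ω g z h * FunAlg.ev k h χ =
      ω z g h * FunAlg.ev k (g * h) χ * ω g h z)
    (hχz : FunAlg.ev k z χ = -1) :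
    BraidedHopfAlgebra (functionQuasiBialgebra ω hω) B :=
  have w : ∀ i, IsWeightVector (diagonalAct e ![1, z]) (FunAlg.ev k ((![1, z] : Fin 2 → G) i))
      (e i) := diagonalAct_isWeightVector e ![1, z]
  have w0 : IsWeightVector (diagonalAct e ![1, z]) (FunAlg.ev k (1 : G)) (e 0) := w 0
  have w1 : IsWeightVector (diagonalAct e ![1, z]) (FunAlg.ev k z) (e 1) := w 1
  have c0 : diagonalCoact e ![1, χ] (e 0) = 1 ⊗ₜ[k] e 0 := diagonalCoact_basis _ _ _
  have c1 : diagonalCoact e ![1, χ] (e 1) = χ ⊗ₜ[k] e 1 := diagonalCoact_basis _ _ _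
  have m00 : primitiveMul e (e 0 ⊗ₜ[k] e 0) = e 0 := primitiveMul_basis e 0 0
  have m01 : primitiveMul e (e 0 ⊗ₜ[k] e 1) = e 1 := primitiveMul_basis e 0 1
  have m10 : primitiveMul e (e 1 ⊗ₜ[k] e 0) = e 1 := primitiveMul_basis e 1 0
  have m11 : primitiveMul e (e 1 ⊗ₜ[k] e 1) = 0 := primitiveMul_basis e 1 1
  have k0 := primitiveComul_zero e
  have k1 := primitiveComul_one e
  have ε0 := primitiveCounit_zero e
  have ε1 := primitiveCounit_one e
  have S0 := primitiveAntipode_zero e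
  have S1 := primitiveAntipode_one e
  have t0 : ∀ i j, (functionQuasiBialgebra ω hω).tensorCoact (diagonalAct e ![1, z])
      (diagonalCoact e ![1, χ]) (diagonalAct e ![1, z]) (diagonalCoact e ![1, χ])
      (e i ⊗ₜ[k] e j) = _ := fun i j => tensorCoact_of_isWeightVector (w i)
        (diagonalCoact_basis _ _ i) (w j) (diagonalCoact_basis _ _ j)
  have t00 := t0 0 0
  have t01 := t0 0 1
  have t10 := t0 1 0
  { toYDModule := diagonalYDModule e ![1, z] ![1, χ]
      (fun i => by fin_cases i <;> simp [hz])
      (fun i => by fin_cases i <;> simp [h1])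
      (fun i g h => by
        fin_cases i
        · simp [hω.one_left, hω.one_mid, hω.one_right]
        · simpa using hχ g h)
    mul := primitiveMul e
    one := e 0
    comul := primitiveComul e
    counit := primitiveCounit e
    antipode := primitiveAntipode e
    one_mul := e.apply_eq_of_forall (f := primitiveMul e ∘ₗ TensorProduct.mk k B B (e 0))
      (g := LinearMap.id) fun i => by fin_cases i <;> simp [m00, m01]
    mul_one := e.apply_eq_of_forall
      (f := primitiveMul e ∘ₗ (TensorProduct.mk k B B).flip (e 0))
      (g := LinearMap.id) fun i => by fin_cases i <;> simp [m00, m10]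
    act_mul := fun h => e.tensor_apply_eq_of_forall
      (f := diagonalAct e ![1, z] h ∘ₗ primitiveMul e)
      (g := primitiveMul e ∘ₗ (functionQuasiBialgebra ω hω).tensorRep
        (diagonalAct e ![1, z]) (diagonalAct e ![1, z]) h) fun i j => by
        rw [LinearMap.comp_apply, LinearMap.comp_apply, (w i).tensorRep (w j), map_smul]
        fin_cases i <;> fin_cases j <;> simp [m00, m01, m10, m11, w0 h, w1 h]
    act_one := w0
    -- Products with two or more factors `e 1` vanish; otherwise one argument of `ω` is `1`, and
    -- normalization makes the associator trivial.
    mul_assoc := e.tensor_tensor_apply_eq_of_forall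
      (f := primitiveMul e ∘ₗ (primitiveMul e).rTensor B)
      (g := primitiveMul e ∘ₗ (primitiveMul e).lTensor B ∘ₗ
        (functionQuasiBialgebra ω hω).associator
        (diagonalAct e ![1, z]) (diagonalAct e ![1, z]) (diagonalAct e ![1, z])) fun i j l => by
        simp only [LinearMap.comp_apply]
        rw [associator_of_isWeightVector (w i) (w j) (w l)]
        fin_cases i <;> fin_cases j <;> fin_cases l <;>
          simp [m00, m01, m10, m11, hω.one_left, hω.one_mid, hω.one_right]
    coact_mul := e.tensor_apply_eq_of_forall
      (f := diagonalCoact e ![1, χ] ∘ₗ primitiveMul e)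
      (g := (primitiveMul e).lTensor _ ∘ₗ (functionQuasiBialgebra ω hω).tensorCoact
        (diagonalAct e ![1, z]) (diagonalCoact e ![1, χ]) (diagonalAct e ![1, z]) (diagonalCoact e ![1, χ]))
      fun i j => by
        rw [LinearMap.comp_apply, LinearMap.comp_apply, t0]
        fin_cases i <;> fin_cases j <;>
          simp [m00, m01, m10, m11, c0, c1, hω.one_left, hω.one_mid, hω.one_right] <;> rfl
    coact_one := c0
    comul_act := fun h => e.apply_eq_of_forall
      (f := primitiveComul e ∘ₗ diagonalAct e ![1, z] h)
      (g := (functionQuasiBialgebra ω hω).tensorRep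
        (diagonalAct e ![1, z]) (diagonalAct e ![1, z]) h ∘ₗ primitiveComul e) fun i => by
        rw [LinearMap.comp_apply, LinearMap.comp_apply, w i]
        fin_cases i
        · simp [k0, w0.tensorRep w0 h]
        · simp [k1, w0.tensorRep w1 h, w1.tensorRep w0 h]
    counit_act := fun h => e.apply_eq_of_forall
      (f := primitiveCounit e ∘ₗ diagonalAct e ![1, z] h)
      (g := LinearMap.mulLeft k (FunAlg.ev k (1 : G) h) ∘ₗ primitiveCounit e) fun i => by
        rw [LinearMap.comp_apply, w i]
        fin_cases i <;> simp [ε0, ε1]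
    counit_comul := e.apply_eq_of_forall
      (f := (TensorProduct.lid k B).toLinearMap ∘ₗ (primitiveCounit e).rTensor B ∘ₗ
        primitiveComul e) (g := LinearMap.id) fun i => by
        fin_cases i <;> simp [ε0, ε1, k0, k1]
    comul_counit := e.apply_eq_of_forall
      (f := (TensorProduct.rid k B).toLinearMap ∘ₗ (primitiveCounit e).lTensor B ∘ₗ
        primitiveComul e) (g := LinearMap.id) fun i => by
        fin_cases i <;> simp [ε0, ε1, k0, k1]
    comul_coassoc := e.apply_eq_of_forall
      (f := (functionQuasiBialgebra ω hω).associator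
        (diagonalAct e ![1, z]) (diagonalAct e ![1, z]) (diagonalAct e ![1, z]) ∘ₗ (primitiveComul e).rTensor B ∘ₗ
        primitiveComul e)
      (g := (primitiveComul e).lTensor B ∘ₗ primitiveComul e) fun i => by
        fin_cases i
        · simp [k0, associator_of_isWeightVector w0 w0 w0, hω.one_left]
        · simp [k0, k1, TensorProduct.add_tmul, TensorProduct.tmul_add,
            associator_of_isWeightVector w0 w0 w1, associator_of_isWeightVector w0 w1 w0,
            associator_of_isWeightVector w1 w0 w0, hω.one_left, hω.one_right, add_assoc]
    coact_comul := e.apply_eq_of_forall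
      (f := (primitiveComul e).lTensor _ ∘ₗ diagonalCoact e ![1, χ])
      (g := (functionQuasiBialgebra ω hω).tensorCoact
        (diagonalAct e ![1, z]) (diagonalCoact e ![1, χ]) (diagonalAct e ![1, z]) (diagonalCoact e ![1, χ]) ∘ₗ primitiveComul e) fun i => by
        rw [LinearMap.comp_apply, LinearMap.comp_apply]
        fin_cases i
        · simp [k0, c0, t00, hω.one_left, hω.one_mid]
          rfl
        · simp [k1, c1, t01, t10, hω.one_left, hω.one_mid, hω.one_right,
            TensorProduct.tmul_add]
          rfl
    coact_counit' := e.apply_eq_of_forall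
      (f := (TensorProduct.rid k _).toLinearMap ∘ₗ (primitiveCounit e).lTensor _ ∘ₗ
        diagonalCoact e ![1, χ])
      (g := (primitiveCounit e).smulRight 1) fun i => by
        fin_cases i <;> simp [ε0, ε1]
    comul_one := k0
    counit_one := ε0
    counit_mul := fun b b' => e.tensor_apply_eq_of_forall
      (f := primitiveCounit e ∘ₗ primitiveMul e)
      (g := LinearMap.mul' k k ∘ₗ
        TensorProduct.map (primitiveCounit e) (primitiveCounit e)) (fun i j => by
        fin_cases i <;> fin_cases j <;> simp [ε0, ε1, m00, m01, m10, m11]) (b ⊗ₜ[k] b')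
    -- The essential case is `i = j = 1`: the left side is zero and the right side is `(1 + χ(z)) e
    -- 1 ⊗ e 1`, zero by `hχz`.
    comul_mul := fun b b' => e.tensor_apply_eq_of_forall
      (f := primitiveComul e ∘ₗ primitiveMul e)
      (g := TensorProduct.map (primitiveMul e) (primitiveMul e) ∘ₗ
        (functionQuasiBialgebra ω hω).interchange (diagonalAct e ![1, z]) (diagonalCoact e ![1, χ]) ∘ₗ
        TensorProduct.map (primitiveComul e) (primitiveComul e)) (fun i j => by
        have I : ∀ i j l m, (functionQuasiBialgebra ω hω).interchange
            (diagonalAct e ![1, z]) (diagonalCoact e ![1, χ])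
            ((e i ⊗ₜ[k] e j) ⊗ₜ[k] (e l ⊗ₜ[k] e m)) = _ := fun i j l m =>
          interchange_of_isWeightVector (w i) (w j) (w l) (w m) (diagonalCoact_basis _ _ j)
        fin_cases i <;> fin_cases j <;>
        simp [m00, m01, m10, m11, k0, k1, I, TensorProduct.add_tmul, TensorProduct.tmul_add,
          h1, hχz, hω.one_left, hω.one_mid, hω.one_right]) (b ⊗ₜ[k] b')
    antipode_act := fun h => e.apply_eq_of_forall
      (f := primitiveAntipode e ∘ₗ diagonalAct e ![1, z] h)
      (g := diagonalAct e ![1, z] h ∘ₗ primitiveAntipode e) fun i => by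
        fin_cases i <;> simp [S0, S1, w0 h, w1 h]
    antipode_coact := e.apply_eq_of_forall
      (f := diagonalCoact e ![1, χ] ∘ₗ primitiveAntipode e)
      (g := (primitiveAntipode e).lTensor _ ∘ₗ diagonalCoact e ![1, χ]) fun i => by
        fin_cases i <;> simp [S0, S1, c0, c1, TensorProduct.tmul_neg]
    antipode_left := e.apply_eq_of_forall
      (f := primitiveMul e ∘ₗ (primitiveAntipode e).rTensor B ∘ₗ primitiveComul e)
      (g := (primitiveCounit e).smulRight (e 0)) fun i => by
        fin_cases i <;> simp [ε0, ε1, S0, S1, k0, k1, m00, m01, m10, TensorProduct.neg_tmul]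
    antipode_right := e.apply_eq_of_forall
      (f := primitiveMul e ∘ₗ (primitiveAntipode e).lTensor B ∘ₗ primitiveComul e)
      (g := (primitiveCounit e).smulRight (e 0)) fun i => by
        fin_cases i <;> simp [ε0, ε1, S0, S1, k0, k1, m00, m01, m10, TensorProduct.tmul_neg] }

end PrimitiveBraidedHopfAlgebra

/-! ### Classification of two-dimensional braided Hopf algebras. -/

section TwoDimensional

variable {k : Type*} [Field k]

theorem Module.Basis.exists_eq_tmul_add_tmul {B M : Type*} [AddCommGroup B] [Module k B]
    [AddCommGroup M] [Module k M] (e : Module.Basis (Fin 2) k B) (t : M ⊗[k] B) :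
    ∃ u v : M, t = u ⊗ₜ[k] e 0 + v ⊗ₜ[k] e 1 := by
  induction t with
  | zero => exact ⟨0, 0, by simp⟩
  | add x y hx hy =>
    obtain ⟨u, v, rfl⟩ := hx
    obtain ⟨u', v', rfl⟩ := hy
    exact ⟨u + u', v + v', by simp only [TensorProduct.add_tmul]; abel⟩
  | tmul m b =>
    refine ⟨e.repr b 0 • m, e.repr b 1 • m, ?_⟩
    rw [TensorProduct.smul_tmul, TensorProduct.smul_tmul, ← TensorProduct.tmul_add]
    congr 1
    have h := e.sum_repr b
    rw [Fin.sum_univ_two] at h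
    exact h.symm

variable {G : Type*} [Group G] [Fintype G] [DecidableEq G]
variable {ω : G → G → G → kˣ} {hω : IsNormalizedThreeCocycle ω}
variable {B : Type*} [AddCommGroup B] [Module k B]

namespace BraidedHopfAlgebra

variable (R : BraidedHopfAlgebra (functionQuasiBialgebra ω hω) B)

/-- The counit cannot be injective for dimension reasons. Since the `P_d` sum to `1`, some `P_d`
does not kill a given nonzero vector of its kernel, and the kernel is stable because the counit is
linear over the action. -/
theorem exists_weightVector_counit_eq_zero (hB : Module.finrank k B = 2) :
    ∃ (d : G) (b : B), b ≠ 0 ∧ R.counit b = 0 ∧ IsWeightVector R.act (FunAlg.ev k d) b := by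
  have : FiniteDimensional k B := FiniteDimensional.of_finrank_pos (by omega)
  obtain ⟨b, hb, hb0⟩ : ∃ b, R.counit b = 0 ∧ b ≠ 0 := by
    by_contra! hcon
    have hinj : Function.Injective R.counit :=
      (injective_iff_map_eq_zero R.counit).2 hcon
    have := LinearMap.finrank_le_finrank_of_injective hinj
    rw [hB, Module.finrank_self] at this
    omega
  obtain ⟨d, hd⟩ : ∃ d : G, R.act (FunAlg.P k d) b ≠ 0 := by
    by_contra! hcon
    apply hb0
    have h1 : R.act 1 b = b := by simp
    rw [← h1, FunAlg.one_eq_sum_P, map_sum, LinearMap.sum_apply]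
    exact Finset.sum_eq_zero fun x _ => hcon x
  refine ⟨d, _, hd, ?_, fun h => ?_⟩
  · rw [R.counit_act, hb, mul_zero]
  · rw [← Module.End.mul_apply, ← map_mul, FunAlg.mul_P, map_smul, LinearMap.smul_apply]

/-- A basis consisting of the unit and of a weight vector in the kernel of the counit. -/
theorem exists_basis (hB : Module.finrank k B = 2) :
    ∃ (d : G) (e : Module.Basis (Fin 2) k B), e 0 = R.one ∧ R.counit (e 1) = 0 ∧
      IsWeightVector R.act (FunAlg.ev k d) (e 1) := by
  obtain ⟨d, b, hb0, hb, hw⟩ := R.exists_weightVector_counit_eq_zero hB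
  have hli : LinearIndependent k ![R.one, b] := by
    rw [LinearIndependent.pair_iff]
    intro s t hst
    have hs := congrArg R.counit hst
    simp [hb, R.counit_one] at hs
    subst hs
    simpa [hb0] using hst
  refine ⟨d, basisOfLinearIndependentOfCardEqFinrank hli (by simp [hB]), ?_⟩
  simp only [coe_basisOfLinearIndependentOfCardEqFinrank]
  exact ⟨rfl, hb, hw⟩

/-- The structure of a two-dimensional braided Hopf algebra in the basis `1, b`: the coaction is
`b ↦ χ ⊗ b`, the square of `b` is `γ b`, and `b ↦ b ⊗ 1 + 1 ⊗ b + t b ⊗ b`. -/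
theorem exists_structure {e : Module.Basis (Fin 2) k B} (he : e 0 = R.one)
    (hε : R.counit (e 1) = 0) :
    ∃ (χ : FunAlg k G) (γ t : k), R.coact (e 1) = χ ⊗ₜ[k] e 1 ∧
      R.mul (e 1 ⊗ₜ[k] e 1) = γ • e 1 ∧
      R.comul (e 1) = e 1 ⊗ₜ[k] e 0 + e 0 ⊗ₜ[k] e 1 + t • (e 1 ⊗ₜ[k] e 1) := by
  have hε0 : R.counit (e 0) = 1 := by rw [he, R.counit_one]
  -- As `e 1` lies in the kernel of the counit, the counit reads off the coefficient of `e 0`.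
  have hdec : ∀ b : B, b = R.counit b • e 0 + e.repr b 1 • e 1 := by
    intro b
    have h := e.sum_repr b
    rw [Fin.sum_univ_two] at h
    have h' := congrArg R.counit h
    simp [hε0, hε] at h'
    rw [← h', h]
  obtain ⟨χ₀, χ, hχ⟩ := e.exists_eq_tmul_add_tmul (R.coact (e 1))
  obtain ⟨u, v, huv⟩ := e.exists_eq_tmul_add_tmul (R.comul (e 1))
  refine ⟨χ, e.repr (R.mul (e 1 ⊗ₜ[k] e 1)) 1, e.repr v 1, ?_, ?_, ?_⟩
  -- Applying the counit to the second leg isolates `χ₀`, and colinearity makes it zero.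
  · have h := R.coact_counit' (e 1)
    rw [hχ] at h
    simp [hε, hε0] at h
    rw [hχ, h, TensorProduct.zero_tmul, zero_add]
  · conv_lhs => rw [hdec (R.mul (e 1 ⊗ₜ[k] e 1)), R.counit_mul, hε, mul_zero, zero_smul, zero_add]
  -- The right counit axiom gives `u = e 1`, the left one gives `v` counit `1`; only the coefficient
  -- of `e 1` in `v` stays free.
  · have h := R.comul_counit (e 1)
    have h' := R.counit_comul (e 1)
    rw [huv] at h h'
    simp [hε, hε0] at h h'
    subst h
    have hv : R.counit v = 1 := by
      rw [hε, zero_smul, zero_add] at h'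
      exact smul_left_injective k (e.ne_zero 1) (h'.trans (one_smul k _).symm)
    rw [huv]
    conv_lhs => rw [hdec v, hv, one_smul, TensorProduct.add_tmul]
    rw [TensorProduct.smul_tmul', add_assoc]

variable {R} {d : G} {e : Module.Basis (Fin 2) k B} {χ : FunAlg k G} {γ t : k}

theorem twistedCharacter_one_of_coact {b : B} (hb : b ≠ 0) (hχ : R.coact b = χ ⊗ₜ[k] b) :
    FunAlg.ev k 1 χ = 1 := by
  have h := R.coact_counit b
  rw [hχ] at h
  exact smul_left_injective k hb (h.trans (one_smul k b).symm)

theorem twistedCharacter_mul_of_coact {b : B} (hb : b ≠ 0)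
    (hw : IsWeightVector R.act (FunAlg.ev k d) b) (hχ : R.coact b = χ ⊗ₜ[k] b) (g h : G) :
    FunAlg.ev k g χ * ω g d h * FunAlg.ev k h χ =
      ω d g h * FunAlg.ev k (g * h) χ * ω g h d :=
  (coact_coassoc_iff hb hw hχ).1 (R.coact_coassoc b) g h

/-- At `(g, g⁻¹)` the twisted relation expresses a multiple of `χ(g)` as a product of units with
`χ(1) = 1`. -/
theorem twistedCharacter_ne_zero_of_coact {b : B} (hb : b ≠ 0)
    (hw : IsWeightVector R.act (FunAlg.ev k d) b) (hχ : R.coact b = χ ⊗ₜ[k] b) (g : G) :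
    FunAlg.ev k g χ ≠ 0 := by
  intro h0
  have h := twistedCharacter_mul_of_coact hb hw hχ g g⁻¹
  rw [h0, mul_inv_cancel, twistedCharacter_one_of_coact hb hχ] at h
  simp at h

/-- Compatibility compares the weights `g * d` and `d * g` with factor `χ(g)`. This factor is
nonzero, and the test function `P_{gd}` separates the two weights if they differ. -/
theorem weight_central_of_coact {b : B} (hb : b ≠ 0)
    (hw : IsWeightVector R.act (FunAlg.ev k d) b) (hχ : R.coact b = χ ⊗ₜ[k] b) (g : G) :
    g * d = d * g := by
  have h := (yd_compat_iff hb hw hχ (FunAlg.P k (g * d))).1 (R.compat _ b) g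
  have h0 := twistedCharacter_ne_zero_of_coact hb hw hχ g
  by_contra hcon
  rw [FunAlg.ev_P, FunAlg.ev_P, if_pos rfl, if_neg fun h => hcon h.symm] at h
  simp [h0] at h

/-- The coefficient of `e 1 ⊗ e 1`. -/
noncomputable def coordTensor (e : Module.Basis (Fin 2) k B) : B ⊗[k] B →ₗ[k] k :=
  LinearMap.mul' k k ∘ₗ TensorProduct.map (e.coord 1) (e.coord 1)

theorem coordTensor_tmul (e : Module.Basis (Fin 2) k B) (i j : Fin 2) :
    coordTensor e (e i ⊗ₜ[k] e j) = if i = 1 ∧ j = 1 then 1 else 0 := by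
  fin_cases i <;> fin_cases j <;> simp [coordTensor]

theorem isWeightVector_one : IsWeightVector R.act (FunAlg.ev k (1 : G)) R.one := R.act_one

/-- A two-dimensional braided Hopf algebra of nontrivial weight `d`: the twisted character takes
the value `-1` at `d`. -/
theorem twistedCharacter_weight_eq_neg_one (hd : d ≠ 1) (he : e 0 = R.one)
    (hw : IsWeightVector R.act (FunAlg.ev k d) (e 1))
    (hχ : R.coact (e 1) = χ ⊗ₜ[k] e 1) (hγ : R.mul (e 1 ⊗ₜ[k] e 1) = γ • e 1)
    (ht : R.comul (e 1) = e 1 ⊗ₜ[k] e 0 + e 0 ⊗ₜ[k] e 1 + t • (e 1 ⊗ₜ[k] e 1)) :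
    FunAlg.ev k d χ = -1 := by
  have hdd : ¬ d * d = d := fun h => hd (mul_eq_left.1 h)
  have w0 : IsWeightVector R.act (FunAlg.ev k (1 : G)) (e 0) := he ▸ isWeightVector_one
  have c0 : R.coact (e 0) = (1 : FunAlg k G) ⊗ₜ[k] e 0 := by rw [he, R.coact_one]
  -- The square of `e 1` has weight `d * d`, yet it is a multiple of `e 1`, of weight `d`; `P_d`
  -- detects the mismatch. The same comparison in `B ⊗ B` kills `t`.
  have hγ0 : γ = 0 := by
    have h := R.act_mul (FunAlg.P k d) (e 1 ⊗ₜ[k] e 1)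
    rw [hw.tensorRep hw, map_smul, hγ, map_smul, hw, FunAlg.ev_P, FunAlg.ev_P, if_pos rfl,
      if_neg hdd, zero_smul, one_smul] at h
    exact (smul_eq_zero.1 h).resolve_right (e.ne_zero 1)
  have ht0 : t = 0 := by
    have h := R.comul_act (FunAlg.P k d) (e 1)
    rw [hw, map_smul, ht, map_add, map_add, map_smul, hw.tensorRep w0, w0.tensorRep hw,
      hw.tensorRep hw] at h
    have h' := congrArg (coordTensor e) h
    simp only [map_add, map_smul, coordTensor_tmul, FunAlg.ev_P, if_neg hdd] at h'
    simpa using h'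
  have m0 : ∀ b, R.mul (e 0 ⊗ₜ[k] b) = b := fun b => by rw [he, R.one_mul]
  have m1 : ∀ b, R.mul (b ⊗ₜ[k] e 0) = b := fun b => by rw [he, R.mul_one]
  -- In the coproduct of the zero element `e 1 * e 1`, the term `e 1 ⊗ e 1` appears once unbraided
  -- and once with factor `χ(d)`, so `1 + χ(d) = 0`.
  have h := R.comul_mul (e 1) (e 1)
  rw [hγ, hγ0, zero_smul, map_zero, ht, ht0, zero_smul, add_zero] at h
  simp only [TensorProduct.add_tmul, TensorProduct.tmul_add, map_add] at h
  rw [interchange_of_isWeightVector hw w0 hw w0 c0, interchange_of_isWeightVector hw w0 w0 hw c0,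
    interchange_of_isWeightVector w0 hw hw w0 hχ, interchange_of_isWeightVector w0 hw w0 hw hχ]
    at h
  simp only [map_smul, TensorProduct.map_tmul, hγ, hγ0, m0, m1, zero_smul,
    TensorProduct.zero_tmul, TensorProduct.tmul_zero, smul_zero] at h
  have h' := congrArg (coordTensor e) h
  simp [coordTensor_tmul, hω.one_left, hω.one_mid, hω.one_right] at h'
  linear_combination -h'

/-- In trivial weight, the parameters of a two-dimensional braided Hopf algebra satisfy
`γ t = -2`. -/
theorem mul_eq_neg_two (he : e 0 = R.one)
    (hw : IsWeightVector R.act (FunAlg.ev k (1 : G)) (e 1)) (hε : R.counit (e 1) = 0)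
    (hχ : R.coact (e 1) = χ ⊗ₜ[k] e 1) (hγ : R.mul (e 1 ⊗ₜ[k] e 1) = γ • e 1)
    (ht : R.comul (e 1) = e 1 ⊗ₜ[k] e 0 + e 0 ⊗ₜ[k] e 1 + t • (e 1 ⊗ₜ[k] e 1)) :
    γ * t = -2 := by
  have w0 : IsWeightVector R.act (FunAlg.ev k (1 : G)) (e 0) := he ▸ isWeightVector_one
  have c0 : R.coact (e 0) = (1 : FunAlg k G) ⊗ₜ[k] e 0 := by rw [he, R.coact_one]
  have hχ1 := twistedCharacter_one_of_coact (e.ne_zero 1) hχ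
  have m0 : ∀ b, R.mul (e 0 ⊗ₜ[k] b) = b := fun b => by rw [he, R.one_mul]
  have m1 : ∀ b, R.mul (b ⊗ₜ[k] e 0) = b := fun b => by rw [he, R.mul_one]
  -- In weight `1` the cocycle factors are trivial and `χ(1) = 1`, so the interchange is the
  -- ordinary flip.
  have I1 : ∀ x y z : B, IsWeightVector R.act (FunAlg.ev k (1 : G)) x →
      IsWeightVector R.act (FunAlg.ev k (1 : G)) y → IsWeightVector R.act (FunAlg.ev k (1 : G)) z →
      (functionQuasiBialgebra ω hω).interchange R.act R.coact
        ((x ⊗ₜ[k] e 1) ⊗ₜ[k] (y ⊗ₜ[k] z)) = (x ⊗ₜ[k] y) ⊗ₜ[k] (e 1 ⊗ₜ[k] z) := by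
    intro x y z hx hy hz
    rw [interchange_of_isWeightVector hx hw hy hz hχ]
    simp [hω.one_left, hχ1]
  have I0 : ∀ x y z : B, IsWeightVector R.act (FunAlg.ev k (1 : G)) x →
      IsWeightVector R.act (FunAlg.ev k (1 : G)) y → IsWeightVector R.act (FunAlg.ev k (1 : G)) z →
      (functionQuasiBialgebra ω hω).interchange R.act R.coact
        ((x ⊗ₜ[k] e 0) ⊗ₜ[k] (y ⊗ₜ[k] z)) = (x ⊗ₜ[k] y) ⊗ₜ[k] (e 0 ⊗ₜ[k] z) := by
    intro x y z hx hy hz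
    rw [interchange_of_isWeightVector hx w0 hy hz c0]
    simp [hω.one_left]
  have h := R.comul_mul (e 1) (e 1)
  rw [hγ, map_smul, ht] at h
  simp only [TensorProduct.add_tmul, TensorProduct.tmul_add, map_add, TensorProduct.tmul_smul,
    ← TensorProduct.smul_tmul', map_smul, I0 _ _ _ hw hw w0, I0 _ _ _ hw w0 hw,
    I0 _ _ _ hw hw hw, I1 _ _ _ w0 hw w0, I1 _ _ _ w0 w0 hw, I1 _ _ _ w0 hw hw,
    I1 _ _ _ hw hw w0, I1 _ _ _ hw w0 hw, I1 _ _ _ hw hw hw] at h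
  simp only [TensorProduct.map_tmul, hγ, m0, m1, TensorProduct.tmul_smul,
    ← TensorProduct.smul_tmul'] at h
  have h' := congrArg (coordTensor e) h
  simp [coordTensor_tmul] at h'
  -- Comparing coefficients of `e 1 ⊗ e 1` gives `γt = 2 + 4γt + (γt)²`.
  have hfac : (γ * t + 1) * (γ * t + 2) = 0 := by linear_combination -h'
  rcases mul_eq_zero.1 hfac with h1 | h2
  -- If `γt = -1`, then `1 + t e 1` is a grouplike idempotent other than `1`, which an antipode
  -- forbids: with `S(e 1) = s + r e 1`, the antipode axiom gives `s = 0` and `1 + r (1 + γt) = 0`.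
  · exfalso
    have a0 : R.antipode (e 0) = e 0 := by
      have := R.antipode_left R.one
      rw [R.comul_one, LinearMap.rTensor_tmul, R.mul_one, R.counit_one, one_smul] at this
      rwa [he]
    have hS := R.antipode_left (e 1)
    have hSb := e.sum_repr (R.antipode (e 1))
    rw [Fin.sum_univ_two] at hSb
    generalize e.repr (R.antipode (e 1)) 0 = s at hSb
    generalize e.repr (R.antipode (e 1)) 1 = r at hSb
    rw [ht] at hS
    simp only [map_add, map_smul, LinearMap.rTensor_tmul, a0, m0, m1, ← hSb,
      TensorProduct.add_tmul, ← TensorProduct.smul_tmul', hγ, hε, zero_smul] at hS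
    have hs := congrArg (e.coord 0) hS
    have hr := congrArg (e.coord 1) hS
    simp at hs hr
    subst hs
    have : (1 : k) = 0 := by linear_combination hr - r * h1
    exact one_ne_zero this
  · linear_combination h2

/-- A two-dimensional braided Hopf algebra of trivial weight is trivial. -/
theorem isTrivial_of_weight_one (h2 : (2 : k) ≠ 0) (he : e 0 = R.one)
    (hw : IsWeightVector R.act (FunAlg.ev k (1 : G)) (e 1)) (hε : R.counit (e 1) = 0)
    (hχ : R.coact (e 1) = χ ⊗ₜ[k] e 1) (hγ : R.mul (e 1 ⊗ₜ[k] e 1) = γ • e 1)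
    (ht : R.comul (e 1) = e 1 ⊗ₜ[k] e 0 + e 0 ⊗ₜ[k] e 1 + t • (e 1 ⊗ₜ[k] e 1)) :
    R.IsTrivial := by
  have hγt := mul_eq_neg_two he hw hε hχ hγ ht
  have hγ0 : γ ≠ 0 := by
    rintro rfl
    exact h2 (by linear_combination hγt)
  have ht0 : t ≠ 0 := by
    rintro rfl
    exact h2 (by linear_combination hγt)
  have w0 : IsWeightVector R.act (FunAlg.ev k (1 : G)) (e 0) := he ▸ isWeightVector_one
  have c0 : R.coact (e 0) = (1 : FunAlg k G) ⊗ₜ[k] e 0 := by rw [he, R.coact_one]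
  have m0 : ∀ b, R.mul (e 0 ⊗ₜ[k] b) = b := fun b => by rw [he, R.one_mul]
  have m1 : ∀ b, R.mul (b ⊗ₜ[k] e 0) = b := fun b => by rw [he, R.mul_one]
  -- Colinearity of the product at `e 1 * e 1 = γ e 1` with `γ ≠ 0` yields `χ(g)² = χ(g)`, and
  -- `χ(g)` is nonzero.
  have hχ1 : χ = 1 := by
    ext g
    have h := R.coact_mul (e 1 ⊗ₜ[k] e 1)
    rw [tensorCoact_of_isWeightVector hw hχ hw hχ, LinearMap.lTensor_tmul, hγ, map_smul, hχ,
      TensorProduct.tmul_smul] at h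
    have h' := congrArg ((TensorProduct.lid k B).toLinearMap ∘ₗ
      (FunAlg.ev k g).toLinearMap.rTensor B) h
    simp only [map_smul, LinearMap.comp_apply, LinearMap.rTensor_tmul,
      AlgHom.toLinearMap_apply, LinearEquiv.coe_coe, TensorProduct.lid_tmul, FunAlg.ev_of] at h'
    have h3 := smul_left_injective k (e.ne_zero 1) (smul_right_injective B hγ0 h')
    simp [hω.one_left, hω.one_mid] at h3
    have hne := twistedCharacter_ne_zero_of_coact (e.ne_zero 1) hw hχ g
    rw [map_one]
    exact mul_left_cancel₀ hne (by rw [← h3, _root_.mul_one])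
  subst hχ1
  -- This is the generator of the group algebra: `v` is grouplike, and `v² = 1 + t (γt + 2) e 1 =
  -- 1`.
  set v : B := e 0 + t • e 1 with hv
  have hli : LinearIndependent k ![e 0, v] := by
    rw [LinearIndependent.pair_iff]
    intro x y hxy
    have hx := congrArg (e.coord 0) hxy
    have hy := congrArg (e.coord 1) hxy
    simp [hv, ht0] at hx hy
    subst hy
    simpa using hx
  have hcard : Fintype.card (Fin 2) = Module.finrank k B :=
    (Module.finrank_eq_card_basis e).symm
  let f := basisOfLinearIndependentOfCardEqFinrank hli hcard
  have f0 : f 0 = e 0 := by simp [f]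
  have f1 : f 1 = v := by simp [f]
  have vw : IsWeightVector R.act (FunAlg.ev k (1 : G)) v := fun h => by
    rw [hv, map_add, map_smul, w0, hw, smul_add, smul_comm]
  have vc : R.coact v = (1 : FunAlg k G) ⊗ₜ[k] v := by
    rw [hv, map_add, map_smul, c0, hχ, TensorProduct.tmul_add, TensorProduct.tmul_smul]
  have k0 : R.comul (e 0) = e 0 ⊗ₜ[k] e 0 := by rw [he, R.comul_one]
  have vk : R.comul v = v ⊗ₜ[k] v := by
    simp only [hv, map_add, map_smul, k0, ht, TensorProduct.tmul_add, TensorProduct.add_tmul,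
      TensorProduct.tmul_smul, ← TensorProduct.smul_tmul', smul_add]
    abel
  have vm : R.mul (v ⊗ₜ[k] v) = e 0 := by
    simp only [hv, map_add, map_smul, m0, m1, hγ, TensorProduct.tmul_add, TensorProduct.add_tmul,
      TensorProduct.tmul_smul, ← TensorProduct.smul_tmul']
    have : e 0 + t • e 1 + t • (e 1 + t • γ • e 1) = e 0 + (t * (γ * t + 2)) • e 1 := by
      module
    rw [this, hγt]
    simp
  have ve : R.counit v = 1 := by
    rw [hv, map_add, map_smul, hε, he, R.counit_one]
    simp
  let b := MonoidAlgebra.basis (Multiplicative (ZMod 2)) k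
  -- `ZMod 2` unfolds to `Fin 2`, so the group law of `C₂` becomes addition of the indices of `f`.
  let σ : Multiplicative (ZMod 2) ≃ Fin 2 := Multiplicative.toAdd
  let E := b.equiv f σ
  have Eb : ∀ i, E (b i) = f (σ i) := fun i => b.equiv_apply i f σ
  have bmul : ∀ i j, b i * b j = b (i * j) := fun i j => by
    simp [b, MonoidAlgebra.single_mul_single]
  have hσ : ∀ i, σ i = 0 ∨ σ i = 1 := fun i => by
    rcases Fin.exists_fin_two.1 ⟨σ i, rfl⟩ with h | h
    · exact Or.inl h
    · exact Or.inr h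
  have fw : ∀ i, IsWeightVector R.act (FunAlg.ev k (1 : G)) (f i) := fun i => by
    fin_cases i
    · exact f0 ▸ w0
    · exact f1 ▸ vw
  have fc : ∀ i, R.coact (f i) = (1 : FunAlg k G) ⊗ₜ[k] f i := fun i => by
    fin_cases i
    · exact f0 ▸ c0
    · exact f1 ▸ vc
  have fk : ∀ i, R.comul (f i) = f i ⊗ₜ[k] f i := fun i => by
    fin_cases i
    · exact f0 ▸ k0
    · exact f1 ▸ vk
  have fe : ∀ i, R.counit (f i) = 1 := fun i => by
    fin_cases i
    · exact f0 ▸ he ▸ R.counit_one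
    · exact f1 ▸ ve
  have fm : ∀ i j : Fin 2, R.mul (f i ⊗ₜ[k] f j) = f (i + j) := fun i j => by
    fin_cases i <;> fin_cases j <;> simp [f0, f1, m0, m1, vm]
  refine ⟨E, fun h x => ?_, fun x => ?_, fun x y => ?_, ?_, fun x => ?_, fun x => ?_⟩
  · refine LinearMap.congr_fun (f := R.act h ∘ₗ E.toLinearMap)
      (g := FunAlg.ev k (1 : G) h • E.toLinearMap) (b.ext fun i => ?_) x
    simp only [LinearMap.comp_apply, LinearEquiv.coe_coe, Eb, LinearMap.smul_apply]
    exact fw _ h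
  · refine LinearMap.congr_fun (f := R.coact ∘ₗ E.toLinearMap)
      (g := TensorProduct.mk k (FunAlg k G) B 1 ∘ₗ E.toLinearMap) (b.ext fun i => ?_) x
    simp only [LinearMap.comp_apply, LinearEquiv.coe_coe, Eb]
    exact fc _
  · refine LinearMap.congr_fun₂
      (f := (TensorProduct.mk k B B).compl₁₂ E.toLinearMap E.toLinearMap |>.compr₂ R.mul)
      (g := (LinearMap.mul k _).compr₂ E.toLinearMap) (b.ext fun i => b.ext fun j => ?_) x y
    simp only [LinearMap.compr₂_apply, LinearMap.compl₁₂_apply, TensorProduct.mk_apply,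
      LinearEquiv.coe_coe, LinearMap.mul_apply', bmul, Eb, fm]
    rfl
  · have : (1 : MonoidAlgebra k (Multiplicative (ZMod 2))) = b 1 := by
      simp [b, MonoidAlgebra.one_def]
    rw [this, Eb, ← he, ← f0]
    rfl
  · refine LinearMap.congr_fun (f := R.comul ∘ₗ E.toLinearMap)
      (g := TensorProduct.map E.toLinearMap E.toLinearMap ∘ₗ Coalgebra.comul)
      (b.ext fun i => ?_) x
    have hb : Coalgebra.comul (R := k) (b i) = b i ⊗ₜ[k] b i := by
      simp [b]
    simp only [LinearMap.comp_apply, LinearEquiv.coe_coe, hb, TensorProduct.map_tmul, Eb, fk]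
  · refine LinearMap.congr_fun (f := R.counit ∘ₗ E.toLinearMap)
      (g := Coalgebra.counit) (b.ext fun i => ?_) x
    simp only [LinearMap.comp_apply, LinearEquiv.coe_coe, Eb, fe]
    simp [b]

end BraidedHopfAlgebra
end TwoDimensional

/-! ### The center of the double dihedral group and twisted characters at `R ^ n`. -/

section DoubleDihedralArithmetic

open QuaternionGroup

variable {n : ℕ}

/-- This is the boundary case: the interval of representatives contains `n` and not `-n`. -/
theorem ZMod.valMinAbs_natCast_self_two_mul (n : ℕ) [NeZero n] :
    ((n : ℕ) : ZMod (2 * n)).valMinAbs = n :=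
  ZMod.valMinAbs_natCast_of_le_half (by omega)

theorem QuaternionGroup.a_natCast_mul_comm (g : QuaternionGroup n) :
    g * a (n : ZMod (2 * n)) = a (n : ZMod (2 * n)) * g := by
  have h : (n : ZMod (2 * n)) + n = 0 := by
    have := ZMod.natCast_self (2 * n)
    push_cast at this
    linear_combination this
  have h' : -(n : ZMod (2 * n)) = n := by linear_combination -h
  cases g with
  | a i => simp [add_comm]
  | xa i => simp [sub_eq_add_neg, h']

theorem QuaternionGroup.a_natCast_ne_one [NeZero n] : a (n : ZMod (2 * n)) ≠ 1 := by
  intro h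
  have h0 : (n : ZMod (2 * n)) = 0 := by simpa using (QuaternionGroup.a.inj h)
  rw [ZMod.natCast_eq_zero_iff] at h0
  have := Nat.le_of_dvd (Nat.pos_of_ne_zero (NeZero.ne n)) h0
  have := NeZero.ne n
  omega

/-- Commuting with `X` forces `2 i = 0` modulo `2 n` for a power `R ^ i`. An element `X R ^ i`
commutes with `R` only if `2 = 0` modulo `2 n`, which `2 ≤ n` excludes. -/
theorem QuaternionGroup.eq_one_or_eq_of_central (hn : 2 ≤ n) {d : QuaternionGroup n}
    (hd : ∀ g, g * d = d * g) : d = 1 ∨ d = a (n : ZMod (2 * n)) := by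
  have : NeZero n := ⟨by omega⟩
  cases d with
  | a i =>
    have h := hd (xa 0)
    simp only [xa_mul_a, a_mul_xa, zero_add, zero_sub, xa.injEq] at h
    have h2 : ((2 * i.val : ℕ) : ZMod (2 * n)) = 0 := by
      rw [Nat.cast_mul, ZMod.natCast_zmod_val]
      push_cast
      linear_combination h
    rw [ZMod.natCast_eq_zero_iff] at h2
    have h3 : n ∣ i.val := Nat.dvd_of_mul_dvd_mul_left (by norm_num) h2
    obtain ⟨c, hc⟩ := h3
    have hlt := ZMod.val_lt i
    have hc2 : c < 2 := by
      by_contra hcc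
      have : n * 2 ≤ n * c := Nat.mul_le_mul_left n (by omega)
      omega
    rw [← ZMod.natCast_zmod_val i, hc]
    interval_cases c
    · left; simp
    · right; simp
  | xa i =>
    have h := hd (a 1)
    simp only [xa_mul_a, a_mul_xa, xa.injEq] at h
    have h2 : ((2 : ℕ) : ZMod (2 * n)) = 0 := by
      push_cast
      linear_combination -h
    rw [ZMod.natCast_eq_zero_iff] at h2
    have := Nat.le_of_dvd (by norm_num) h2
    omega

theorem expX_a (i : ZMod (2 * n)) : expX (a i) = 0 := rfl

theorem expX_xa (i : ZMod (2 * n)) : expX (xa i) = 1 := rfl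

/-- The exponent of `ξ` in the multiplier of the characters twisted by the central element
`R ^ n`. -/
theorem cocExp_central [NeZero n] (g h : QuaternionGroup n) :
    ∃ m : ℤ, cocExp (a (n : ZMod (2 * n))) g h + cocExp g h (a (n : ZMod (2 * n))) =
      cocExp g (a (n : ZMod (2 * n))) h + expX h * (n ^ 2 * expX g - 2 * n * expR g) +
        2 * n ^ 2 * m := by
  obtain ⟨q, hq⟩ := expR_mul g h
  have hR : expR (a (n : ZMod (2 * n))) = n := ZMod.valMinAbs_natCast_self_two_mul n
  simp only [cocExp, hR, expX_a, a_natCast_mul_comm h, hq]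
  -- By centrality the same residue occurs in both terms with first argument `g`, so it cancels and
  -- its value is irrelevant.
  generalize expR (a (n : ZMod (2 * n)) * h) = r
  rcases expX_cases g with hg | hg <;> rcases expX_cases h with hh | hh <;>
    simp only [hg, hh]
  -- The term with first argument `R ^ n` is `±n (2nq - nAB)`, whence the sign of `q`. In the last
  -- case `-n²` is rewritten as `n² - 2n²`, whence `q - 1`.
  · exact ⟨q, by ring⟩
  · exact ⟨-q, by ring⟩
  · exact ⟨-q, by ring⟩
  · exact ⟨q - 1, by ring⟩

variable {k : Type*} [Field k] {ξ ξ₄ : kˣ}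

theorem dihedralCocycle_eq (p : ℕ) (x y z : QuaternionGroup n) :
    dihedralCocycle n ξ ξ₄ p x y z =
      ξ ^ ((p : ℤ) * cocExp x y z) * ξ₄ ^ (-((p : ℤ) * expX x * expX y * expX z)) := by
  rw [dihedralCocycle, expR_mul_eq_balancedRem, cocExp]

/-- The last factor is the multiplier of the twisted characters. `ξ₄` drops out because one argument
of each cocycle value is `R ^ n`, whose exponent of `X` is zero. -/
theorem dihedralCocycle_central [NeZero n] (hξ : ξ ^ (2 * n ^ 2) = 1) (p : ℕ)
    (g h : QuaternionGroup n) :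
    dihedralCocycle n ξ ξ₄ p (a (n : ZMod (2 * n))) g h *
        dihedralCocycle n ξ ξ₄ p g h (a (n : ZMod (2 * n))) =
      dihedralCocycle n ξ ξ₄ p g (a (n : ZMod (2 * n))) h *
        ξ ^ ((p : ℤ) * (expX h * (n ^ 2 * expX g - 2 * n * expR g))) := by
  obtain ⟨m, hm⟩ := cocExp_central g h
  have hξ' : ξ ^ ((p : ℤ) * (2 * n ^ 2 * m)) = 1 := by
    rw [mul_left_comm, zpow_mul]
    exact_mod_cast (congrArg (· ^ ((p : ℤ) * m)) hξ).trans (one_zpow _)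
  simp only [dihedralCocycle_eq, expX_a]
  simp only [Nat.cast_zero, mul_zero, zero_mul, neg_zero, zpow_zero, mul_one]
  rw [← zpow_add, ← mul_add, hm, mul_add, mul_add, zpow_add, zpow_add, hξ', mul_one]

theorem pow_sq_eq_neg_one (hn : n ≠ 0) (hξ : IsPrimitiveRoot ξ (2 * n ^ 2)) :
    ξ ^ (n ^ 2) = -1 := by
  have h : IsPrimitiveRoot (ξ ^ (n ^ 2)) 2 :=
    hξ.pow (by positivity) (by ring)
  have h' := IsPrimitiveRoot.eq_neg_one_of_two_right
    (IsPrimitiveRoot.coe_units_iff.2 h)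
  exact Units.ext (by simpa using h')

/-- Twisted characters at `R ^ n` with value `-1` there force a parity condition. -/
theorem odd_or_odd_of_twistedCharacter [NeZero n] (hn : 2 ≤ n)
    (hξ : IsPrimitiveRoot ξ (2 * n ^ 2)) (p : ℕ) (χ : QuaternionGroup n → k)
    (h0 : ∀ g, χ g ≠ 0)
    (hχ : ∀ g h, χ g * χ h =
      χ (g * h) * (ξ ^ ((p : ℤ) * (expX h * (n ^ 2 * expX g - 2 * n * expR g))) : kˣ))
    (hz : χ (a (n : ZMod (2 * n))) = -1) : Odd p ∨ Odd n := by
  by_contra hcon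
  rw [not_or, Nat.not_odd_iff_even, Nat.not_odd_iff_even] at hcon
  obtain ⟨⟨l, hl⟩, m, hm⟩ := hcon
  have h1 : χ 1 = 1 := by
    have h := hχ 1 1
    have hX : expX (1 : QuaternionGroup n) = 0 := rfl
    simp [hX] at h
    exact mul_left_cancel₀ (h0 1) (h.trans (mul_one _).symm)
  -- The multiplier is trivial when the right factor is a power of `R`.
  have hRg : ∀ (g : QuaternionGroup n) (i : ZMod (2 * n)), χ g * χ (a i) = χ (g * a i) := by
    intro g i
    have h := hχ g (a i)
    simpa [expX_a] using h
  have hpow : ∀ j : ℕ, χ (a (j : ZMod (2 * n))) = χ (a 1) ^ j := by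
    intro j
    induction j with
    | zero => simpa using h1
    | succ j ih =>
      rw [pow_succ, ← ih, hRg]
      simp
  have hR1 : expR (a 1 : QuaternionGroup n) = 1 := by
    have h := ZMod.valMinAbs_natCast_of_le_half (n := 2 * n) (a := 1) (by omega)
    simpa [expR] using h
  -- Evaluating `χ` on both forms of `R X = X R⁻¹` determines `χ(R)²`.
  have hX := hχ (a 1) (xa 0)
  have hX' := hRg (xa 0) (-1)
  have hinv := hRg (a 1) (-1)
  simp only [xa_mul_a, a_mul_a, a_mul_xa, zero_add, zero_sub, add_neg_cancel, hR1, expX_a,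
    expX_xa] at hX hX' hinv
  have hone : χ (a 0) = 1 := h1
  rw [hone] at hinv
  rw [← hX'] at hX
  have hsq : χ (a 1) ^ 2 = (ξ ^ ((p : ℤ) * (-(2 * n))) : kˣ) := by
    have hc : χ (xa 0) * (χ (a 1) ^ 2) =
        χ (xa 0) * (ξ ^ ((p : ℤ) * (-(2 * n))) : kˣ) := by
      have e : (p : ℤ) * (((1 : ℕ) : ℤ) * ((n : ℤ) ^ 2 * ((0 : ℕ) : ℤ) - 2 * n * 1)) =
        (p : ℤ) * (-(2 * n)) := by push_cast; ring
      rw [e] at hX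
      linear_combination χ (a 1) * hX +
        χ (xa 0) * (ξ ^ ((p : ℤ) * (-(2 * n))) : kˣ) * hinv
    exact mul_left_cancel₀ (h0 _) hc
  have hzn := hpow n
  -- For even `n` the sign of `χ(R)` does not affect `χ(R^n)`, and for even `p` the resulting
  -- exponent of `ξ` is a multiple of `2 n²`; so `χ(R^n) = 1`, against `-1 ≠ 1`.
  have e0 : χ (a 1) ^ n = (χ (a 1) ^ 2) ^ m := by rw [← pow_mul]; congr 1; omega
  rw [hz, e0, hsq, ← Units.val_pow_eq_pow_val, ← zpow_natCast,
    ← zpow_mul] at hzn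
  have e : (p : ℤ) * (-(2 * n)) * m = ((2 * n ^ 2 : ℕ) : ℤ) * (-l) := by
    rw [hl, hm]; push_cast; ring
  rw [e, zpow_mul, zpow_natCast, hξ.pow_eq_one, one_zpow, Units.val_one] at hzn
  have h2 := congrArg Units.val (pow_sq_eq_neg_one (by omega) hξ)
  have h3 : ξ ^ (n ^ 2) = 1 := Units.ext (by rw [h2]; simpa using hzn)
  have := hξ.pow_ne_one_of_pos_of_lt (l := n ^ 2) (by positivity)
    (by have : 0 < n ^ 2 := by positivity
        omega)
  exact this h3

/-- The root `ξ^(-np)` has `n`-th power `(-1)^p`. It serves for odd `p`; for even `p` its negative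
serves, since `n` is then odd. -/
theorem exists_twistedCharacter_root (hn : 2 ≤ n) (hξ : IsPrimitiveRoot ξ (2 * n ^ 2)) (p : ℕ)
    (h : Odd p ∨ Odd n) :
    ∃ ζ : kˣ, ζ ^ 2 = ξ ^ (-(2 * n * p : ℤ)) ∧ ζ ^ n = -1 := by
  have hm := pow_sq_eq_neg_one (by omega) hξ
  have e2 : (ξ ^ (-(n * p : ℤ))) ^ 2 = ξ ^ (-(2 * n * p : ℤ)) := by
    rw [← zpow_natCast, ← zpow_mul]
    congr 1
    push_cast
    ring
  have en : (ξ ^ (-(n * p : ℤ))) ^ n = (-1) ^ p := by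
    have : ((ξ ^ (-(n * p : ℤ))) ^ n)⁻¹ = (-1) ^ p := by
      rw [← hm, ← zpow_natCast, ← zpow_mul, ← zpow_neg, ← pow_mul, ← zpow_natCast]
      congr 1
      push_cast
      ring
    rw [← inv_inj, this, ← inv_pow, inv_neg, inv_one]
  rcases Nat.even_or_odd p with hp | hp
  · have hn' : Odd n := h.resolve_left (Nat.not_odd_iff_even.2 hp)
    refine ⟨-(ξ ^ (-(n * p : ℤ))), ?_, ?_⟩
    · rw [neg_sq, e2]
    · rw [hn'.neg_pow, en, hp.neg_one_pow]
  · exact ⟨_, e2, by rw [en, hp.neg_one_pow]⟩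

/-- The twisted character `X ^ A R ^ a ↦ τ ^ A ζ ^ a`. -/
def twistedCharacter (τ ζ : kˣ) (g : QuaternionGroup n) : kˣ := τ ^ expX g * ζ ^ expR g

/-- Since `ζ^(2n) = 1`, reduction of exponents modulo `2 n` is harmless. Moving `R ^ a` past `X`
inverts it, which `ζ² = ξ^(-2np)` compensates. The relation `X² = R^n` requires `χ(X)² = -ξ^(n² p)`,
and this dictates the choice `ξ₄^(p+1)`. -/
theorem twistedCharacter_mul (hn : n ≠ 0) (hξ : IsPrimitiveRoot ξ (2 * n ^ 2))
    (hξ₄ : ξ₄ ^ 2 = ξ ^ (n ^ 2)) (p : ℕ) {ζ : kˣ} (h2 : ζ ^ 2 = ξ ^ (-(2 * n * p : ℤ)))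
    (hζ : ζ ^ n = -1) (g h : QuaternionGroup n) :
    twistedCharacter (ξ₄ ^ (p + 1)) ζ g * twistedCharacter (ξ₄ ^ (p + 1)) ζ h =
      twistedCharacter (ξ₄ ^ (p + 1)) ζ (g * h) *
        ξ ^ ((p : ℤ) * (expX h * (n ^ 2 * expX g - 2 * n * expR g))) := by
  obtain ⟨q, hq⟩ := expR_mul g h
  have hm := pow_sq_eq_neg_one hn hξ
  have hτ : (ξ₄ ^ (p + 1)) ^ 2 = -ξ ^ (n ^ 2 * p) := by
    rw [← pow_mul, mul_comm, pow_mul, hξ₄, ← pow_mul, mul_add, pow_add, mul_one, hm]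
    simp
  have hζn : ζ ^ (n : ℤ) = -1 := by rw [zpow_natCast, hζ]
  have hq2 : ζ ^ (2 * n * q : ℤ) = 1 := by
    rw [mul_assoc, mul_comm, mul_assoc, zpow_mul, hζn, mul_comm, zpow_mul]
    simp
  have hξp : ξ ^ (n ^ 2 * p) * ξ ^ (n ^ 2 * p) = 1 := by
    rw [← pow_add, ← two_mul, ← mul_assoc, pow_mul, hξ.pow_eq_one, one_pow]
  have hzz : ζ ^ (2 : ℤ) = ξ ^ (-(2 * n * p : ℤ)) := by exact_mod_cast h2
  have key : ∀ j : ℤ, ζ ^ (2 * j) = ξ ^ (-(2 * n * p * j : ℤ)) := by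
    intro j
    rw [zpow_mul, hzz, ← zpow_mul]
    congr 1
    ring
  have hX : expX (g * h) + 2 * (expX g * expX h) = expX g + expX h := by
    have := expX_mul g h
    zify
    linarith
  simp only [twistedCharacter]
  generalize hT : ξ₄ ^ (p + 1) = T at *
  rw [hq, zpow_sub, hq2]
  rcases expX_cases g with hg | hg <;> rcases expX_cases h with hh | hh <;>
    simp only [hg, hh] at hX ⊢
  · have : expX (g * h) = 0 := by omega
    simp [this, zpow_add]
  · have : expX (g * h) = 1 := by omega
    have e := key (expR g)
    simp only [this]
    have e' : ζ ^ expR g = ζ ^ (-expR g) * ξ ^ (-(2 * n * p * expR g : ℤ)) := by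
      rw [← e, ← zpow_add]; congr 1; ring
    simp only [pow_zero, pow_one, one_mul]
    rw [e', zpow_add, zpow_add]
    have : (p : ℤ) * (((1 : ℕ) : ℤ) * ((n : ℤ) ^ 2 * ((0 : ℕ) : ℤ) - 2 * n * expR g)) =
      -(2 * n * p * expR g : ℤ) := by push_cast; ring
    rw [this]
    simp
    ac_rfl
  · have : expX (g * h) = 1 := by omega
    simp [this, zpow_add, mul_assoc]
  · have : expX (g * h) = 0 := by omega
    have e := key (expR g)
    simp only [this]
    have e' : ζ ^ expR g = ζ ^ (-expR g) * ξ ^ (-(2 * n * p * expR g : ℤ)) := by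
      rw [← e, ← zpow_add]; congr 1; ring
    simp only [pow_zero, pow_one, one_mul]
    rw [e', zpow_add, zpow_add]
    have : (p : ℤ) * (((1 : ℕ) : ℤ) * ((n : ℤ) ^ 2 * ((1 : ℕ) : ℤ) - 2 * n * expR g)) =
      ((n ^ 2 * p : ℕ) : ℤ) + -(2 * n * p * expR g : ℤ) := by push_cast; ring
    rw [this, zpow_add ξ, zpow_natCast]
    have hs : T * (ζ ^ (-expR g) * ξ ^ (-(2 * n * p * expR g : ℤ))) * (T * ζ ^ expR h) =
      T ^ 2 * (ζ ^ (-expR g) * ξ ^ (-(2 * n * p * expR g : ℤ)) * ζ ^ expR h) := by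
      rw [sq]; ac_rfl
    rw [hs, hτ]
    -- The exponent `n` coming from `X² = R^n` contributes `ζ^n = -1`, matching the sign in `hτ`.
    simp [hζn]
    ac_rfl

theorem twistedCharacter_one (τ ζ : kˣ) : twistedCharacter τ ζ (1 : QuaternionGroup n) = 1 := by
  have hX1 : expX (1 : QuaternionGroup n) = 0 := rfl
  have hR1 : expR (1 : QuaternionGroup n) = 0 := ZMod.valMinAbs_zero (2 * n)
  simp [twistedCharacter, hX1, hR1]

theorem twistedCharacter_a_natCast [NeZero n] (τ ζ : kˣ) :
    twistedCharacter τ ζ (a (n : ZMod (2 * n))) = ζ ^ n := by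
  have hR : expR (a (n : ZMod (2 * n))) = n := ZMod.valMinAbs_natCast_self_two_mul n
  simp [twistedCharacter, expX_a, hR]

end DoubleDihedralArithmetic

/-! ### The parity criterion and the main theorem. -/

section Parity

open QuaternionGroup

variable {k : Type*} [Field k] {n : ℕ} [NeZero n] {ξ ξ₄ : kˣ}

/-- Over the double dihedral group, the twisted multiplicativity of a function in terms of the
explicit multiplier. -/
theorem dihedralCocycle_twisted_iff (hξ : ξ ^ (2 * n ^ 2) = 1) (p : ℕ)
    (χ : QuaternionGroup n → k) (g h : QuaternionGroup n) :
    (χ g * dihedralCocycle n ξ ξ₄ p g (a (n : ZMod (2 * n))) h * χ h =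
        dihedralCocycle n ξ ξ₄ p (a (n : ZMod (2 * n))) g h * χ (g * h) *
          dihedralCocycle n ξ ξ₄ p g h (a (n : ZMod (2 * n)))) ↔
      χ g * χ h =
        χ (g * h) * (ξ ^ ((p : ℤ) * (expX h * (n ^ 2 * expX g - 2 * n * expR g))) : kˣ) := by
  have hc := congrArg Units.val (dihedralCocycle_central (ξ₄ := ξ₄) hξ p g h)
  rw [Units.val_mul, Units.val_mul] at hc
  have hne := (dihedralCocycle n ξ ξ₄ p g (a (n : ZMod (2 * n))) h).ne_zero
  constructor
  · intro H
    apply mul_left_cancel₀ hne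
    linear_combination H + χ (g * h) * hc
  · intro H
    linear_combination
      (dihedralCocycle n ξ ξ₄ p g (a (n : ZMod (2 * n))) h : k) * H - χ (g * h) * hc

/-- In characteristic two, `ξ^(n²) = -1 = 1` would contradict the order of `ξ`. -/
theorem two_ne_zero_of_isPrimitiveRoot (hξ : IsPrimitiveRoot ξ (2 * n ^ 2)) : (2 : k) ≠ 0 := by
  intro h2
  have h := congrArg Units.val (pow_sq_eq_neg_one (NeZero.ne n) hξ)
  have h1 : ξ ^ (n ^ 2) = 1 := Units.ext (by
    rw [h, Units.val_neg, Units.val_one]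
    linear_combination -h2)
  have hn : 0 < n ^ 2 := pow_pos (Nat.pos_of_ne_zero (NeZero.ne n)) 2
  exact hξ.pow_ne_one_of_pos_of_lt hn.ne' (by omega) h1

end Parity

theorem mainTheorem9 {k : Type u} [Field k] (n : ℕ) [NeZero n] (hn : 2 ≤ n)
    (ξ ξ₄ : kˣ) (hξ : IsPrimitiveRoot ξ (2 * n ^ 2)) (hξ₄ : ξ₄ ^ 2 = ξ ^ (n ^ 2))
    (p : ℕ) (hp : p ≤ 2 * n - 1) :
    (∃ (B : Type u) (_ : AddCommGroup B) (_ : Module k B)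
        (R : BraidedHopfAlgebra
          (functionQuasiHopfAlgebra (dihedralCocycle n ξ ξ₄ p)
            (dihedralCocycle_isNormalizedThreeCocycle n ξ ξ₄ hξ.pow_eq_one hξ₄
              p)).toQuasiBialgebra B),
        Module.finrank k B = 2 ∧ ¬ R.IsTrivial) ↔
      (Odd p ∨ ¬ (Even p ↔ Even n)) := by
  have hω := dihedralCocycle_isNormalizedThreeCocycle n ξ ξ₄ hξ.pow_eq_one hξ₄ p
  have hpar : (Odd p ∨ ¬ (Even p ↔ Even n)) ↔ (Odd p ∨ Odd n) := by
    rw [← Nat.not_even_iff_odd, ← Nat.not_even_iff_odd]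
    tauto
  rw [hpar]
  constructor
  · rintro ⟨B, _, _, R, hB, hR⟩
    change BraidedHopfAlgebra (functionQuasiBialgebra (dihedralCocycle n ξ ξ₄ p) hω) B at R
    obtain ⟨d, e, he, hε, hw⟩ := R.exists_basis hB
    obtain ⟨χ, γ, t, hχ, hγ, ht⟩ := R.exists_structure he hε
    have hd : d ≠ 1 := by
      rintro rfl
      exact hR (BraidedHopfAlgebra.isTrivial_of_weight_one
        (two_ne_zero_of_isPrimitiveRoot hξ) he hw hε hχ hγ ht)
    have hdn := (QuaternionGroup.eq_one_or_eq_of_central hn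
      (BraidedHopfAlgebra.weight_central_of_coact (e.ne_zero 1) hw hχ)).resolve_left hd
    subst hdn
    exact odd_or_odd_of_twistedCharacter hn hξ p (fun g => FunAlg.ev k g χ)
      (BraidedHopfAlgebra.twistedCharacter_ne_zero_of_coact (e.ne_zero 1) hw hχ)
      (fun g h => (dihedralCocycle_twisted_iff hξ.pow_eq_one p _ g h).1
        (BraidedHopfAlgebra.twistedCharacter_mul_of_coact (e.ne_zero 1) hw hχ g h))
      (BraidedHopfAlgebra.twistedCharacter_weight_eq_neg_one hd he hw hχ hγ ht)
  · intro h
    obtain ⟨ζ, hζ2, hζn⟩ := exists_twistedCharacter_root hn hξ p h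
    let χ : QuaternionGroup n → k := fun g => (twistedCharacter (ξ₄ ^ (p + 1)) ζ g : kˣ)
    let e := Pi.basisFun k (Fin 2)
    let R : BraidedHopfAlgebra (functionQuasiBialgebra (dihedralCocycle n ξ ξ₄ p) hω)
        (Fin 2 → k) :=
      primitiveBraidedHopfAlgebra e (QuaternionGroup.a (n : ZMod (2 * n))) (FunAlg.of χ)
        QuaternionGroup.a_natCast_mul_comm
        (by simp [χ, twistedCharacter_one])
        (fun g h => (dihedralCocycle_twisted_iff hξ.pow_eq_one p χ g h).2 (by
          rw [← Units.val_mul, twistedCharacter_mul (NeZero.ne n) hξ hξ₄ p hζ2 hζn,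
            Units.val_mul]))
        (by simp [χ, twistedCharacter_a_natCast, hζn])
    refine ⟨Fin 2 → k, inferInstance, inferInstance, R, by simp, ?_⟩
    -- The action alone obstructs triviality: `P_1` kills `e 1`, of weight `R^n ≠ 1`, whereas a
    -- trivial action would fix it because `ε(P_1) = 1`.
    rintro ⟨E, hact, -⟩
    have h1 := hact (FunAlg.P k (1 : QuaternionGroup n)) (E.symm (e 1))
    rw [LinearEquiv.apply_symm_apply] at h1
    have h2 : R.act (FunAlg.P k (1 : QuaternionGroup n)) (e 1) = _ :=
      diagonalAct_isWeightVector e ![1, QuaternionGroup.a (n : ZMod (2 * n))] 1 (FunAlg.P k 1)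
    have h3 : (functionQuasiHopfAlgebra (dihedralCocycle n ξ ξ₄ p) hω).ε
        (FunAlg.P k (1 : QuaternionGroup n)) = 1 := by
      change FunAlg.ev k 1 (FunAlg.P k (1 : QuaternionGroup n)) = 1
      simp
    rw [h3, one_smul] at h1
    rw [h1] at h2
    simp only [Matrix.cons_val_one, Matrix.cons_val_fin_one, FunAlg.ev_P,
      if_neg QuaternionGroup.a_natCast_ne_one, zero_smul] at h2
    exact e.ne_zero 1 h2
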